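/- Let $M=\mathbb Z^n\subset M_{\mathbb R}=\mathbb R^n$, let $P\subset M_{\mathbb R}$ be a full-dimensional lattice polytope, let $\varphi\colon M_{\mathbb R}\to\mathbb C$ be a homogeneous polynomial function, and let $f=\{f_Q\}$ be a family of Laurent polynomials $f_Q(y)\in\mathbb Z[y^{\pm1}]$ indexed by the non-empty faces $Q\preceq P$ (including $P$). For an integer $\ell>0$ put $$E^\varphi_{P,f}(\ell,y)=\sum_{\emptyset\ne Q\preceq P} f_Q(y)\,(1+y)^{\dim Q+\deg\varphi}\sum_{m\in\mathrm{Relint}(\ell Q)\cap M}\varphi(m),$$ $$\widetilde E^\varphi_{P,f}(\ell,y)=\sum_{\emptyset\ne Q\preceq P} f_Q(y)\,(1+y)^{\dim Q}\sum_{m\in\mathrm{Relint}(\ell Q)\cap M}\varphi(m),$$ so that $E^\varphi_{P,f}=(1+y)^{\deg\varphi}\,\widetilde E^\varphi_{P,f}$. For every weight $f$ there are unique polynomials $E^\varphi_{P,f}(z,y)$ and $\widetilde E^\varphi_{P,f}(z,y)$ in $z$ with coefficients in $\mathbb C[y^{\pm1}]$ that take these values at $z=\ell$ for all integers $\ell>0$;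 through them $E^\varphi_{P,f}(\ell,y)$ and $\widetilde E^\varphi_{P,f}(\ell,y)$ are defined for all $\ell\in\mathbb Z$. Define the dual weight $\mathbb D(f)$ by $$\mathbb D(f)_Q(y)=\sum_{Q\preceq E\preceq P}(1+y)^{\dim E-\dim Q}\,(-y)^{-\dim E}\,f_E(1/y).$$ Then for all $\ell\in\mathbb Z$, $$E^\varphi_{P,f}(-\ell,y)=(-y)^{\deg\varphi}\,E^\varphi_{P,\mathbb D(f)}(\ell,1/y),\qquad \widetilde E^\varphi_{P,f}(-\ell,y)=(-1)^{\deg\varphi}\,\widetilde E^\varphi_{P,\mathbb D(f)}(\ell,1/y).$$ (If $\varphi=0$, any natural number may be taken as $\deg\varphi$.) -/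

import Mathlib

open scoped LaurentPolynomial Pointwise

/-- The lattice point `m ∈ M = ℤⁿ`, seen in `M_ℝ = ℝⁿ`. -/
def latticeVec {n : ℕ} (m : Fin n → ℤ) : Fin n → ℝ := fun i => (m i : ℝ)

/-- A full-dimensional lattice polytope in `M_ℝ = ℝⁿ`: the convex hull of finitely many points of
`M = ℤⁿ` whose affine span is all of `ℝⁿ`. -/
structure LatticePolytope (n : ℕ) where
  carrier : Set (Fin n → ℝ)
  isLattice : ∃ s : Finset (Fin n → ℤ), carrier = convexHull ℝ (latticeVec '' (s : Set (Fin n → ℤ)))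
  fullDim : affineSpan ℝ carrier = ⊤

namespace LatticePolytope

variable {n : ℕ}

/-- The non-empty faces of `P` (including `P` itself): the non-empty sets of the form
`{x ∈ P | u is maximal on P at x}` for a linear functional `u`. -/
def Face (P : LatticePolytope n) : Type :=
  {Q : Set (Fin n → ℝ) // Q.Nonempty ∧ IsExposed ℝ P.carrier Q}

/-- The points of a face. -/
def Face.pts {P : LatticePolytope n} (Q : P.Face) : Set (Fin n → ℝ) := Q.1

/-- The dimension of a face: the dimension of the linear space parallel to its affine hull. -/
noncomputable def Face.dim {P : LatticePolytope n} (Q : P.Face) : ℕ :=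
  Module.finrank ℝ (vectorSpan ℝ Q.pts)

theorem Face.dim_mono {P : LatticePolytope n} {Q E : P.Face} (h : Q.pts ⊆ E.pts) :
    Q.dim ≤ E.dim :=
  Submodule.finrank_mono (vectorSpan_mono ℝ h)

theorem isCompact_carrier (P : LatticePolytope n) : IsCompact P.carrier := by
  obtain ⟨s, hs⟩ := P.isLattice
  rw [hs]
  exact (s.finite_toSet.image _).isCompact_convexHull ℝ

theorem convex_carrier (P : LatticePolytope n) : Convex ℝ P.carrier := by
  obtain ⟨s, hs⟩ := P.isLattice
  rw [hs]
  exact convex_convexHull ℝ _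

theorem finite_face (P : LatticePolytope n) : Finite P.Face := by
  obtain ⟨s, hs⟩ := P.isLattice
  have hfin : (latticeVec '' (s : Set (Fin n → ℤ))).Finite := s.finite_toSet.image _
  have hsub : ∀ Q : P.Face, Q.pts.extremePoints ℝ ⊆ latticeVec '' (s : Set (Fin n → ℤ)) := by
    intro Q x hx
    have h := Q.2.2.isExtreme.extremePoints_subset_extremePoints hx
    rw [hs] at h
    exact extremePoints_convexHull_subset h
  have : Finite ↥(𝒫 (latticeVec '' (s : Set (Fin n → ℤ)))) := hfin.finite_subsets.to_subtype
  refine Finite.of_injective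
    (fun Q : P.Face => (⟨Q.pts.extremePoints ℝ, hsub Q⟩ : ↥(𝒫 (latticeVec '' (s : Set (Fin n → ℤ))))))
    ?_
  intro Q R hQR
  have h : Q.pts.extremePoints ℝ = R.pts.extremePoints ℝ := congrArg Subtype.val hQR
  have hQ := closure_convexHull_extremePoints (Q.2.2.isCompact P.isCompact_carrier)
    (Q.2.2.convex P.convex_carrier)
  have hR := closure_convexHull_extremePoints (R.2.2.isCompact P.isCompact_carrier)
    (R.2.2.convex P.convex_carrier)
  apply Subtype.ext
  rw [← hQ, ← hR]
  exact congrArg (fun t => closure (convexHull ℝ t)) h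

noncomputable instance (P : LatticePolytope n) : Fintype P.Face :=
  @Fintype.ofFinite _ P.finite_face

/-- The lattice points in the relative interior of the dilated face `ℓQ`. -/
def relintPoints {P : LatticePolytope n} (Q : P.Face) (l : ℕ) : Set (Fin n → ℤ) :=
  {m | latticeVec m ∈ intrinsicInterior ℝ ((l : ℝ) • Q.pts)}

theorem finite_relintPoints {P : LatticePolytope n} (Q : P.Face) (l : ℕ) :
    (relintPoints Q l).Finite := by
  have hb : Bornology.IsBounded ((l : ℝ) • Q.pts) :=
    (P.isCompact_carrier.isBounded.subset Q.2.2.subset).smul₀ _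
  obtain ⟨R, hR⟩ := hb.subset_closedBall 0
  refine (Set.finite_Icc (fun _ => -⌈R⌉ : Fin n → ℤ) (fun _ => ⌈R⌉)).subset ?_
  intro m hm
  have h := hR (intrinsicInterior_subset hm)
  rw [mem_closedBall_zero_iff] at h
  have h' : ∀ i, |(m i : ℝ)| ≤ (⌈R⌉ : ℤ) := fun i =>
    ((norm_le_pi_norm (latticeVec m) i).trans h).trans (Int.le_ceil R)
  constructor
  · intro i
    have := (abs_le.1 (h' i)).1
    exact_mod_cast this
  · intro i
    have := (abs_le.1 (h' i)).2
    exact_mod_cast this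

/-- The value `φ(m)` of the polynomial `φ` at a lattice point. -/
noncomputable def evalLattice (φ : MvPolynomial (Fin n) ℂ) (m : Fin n → ℤ) : ℂ :=
  MvPolynomial.eval (fun i => (m i : ℂ)) φ

/-- `∑ φ(m)` over the lattice points `m` in the relative interior of `ℓQ`. -/
noncomputable def relintSum {P : LatticePolytope n} (φ : MvPolynomial (Fin n) ℂ) (Q : P.Face)
    (l : ℕ) : ℂ :=
  ∑ m ∈ (finite_relintPoints Q l).toFinset, evalLattice φ m

/-- A weight vector: a Laurent polynomial `f_Q(y) ∈ ℤ[y, y⁻¹]` for each non-empty face `Q`.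
The variable `y` is `LaurentPolynomial.T 1`. -/
abbrev Weight (P : LatticePolytope n) : Type := P.Face → ℤ[T;T⁻¹]

/-- The inclusion `ℤ[y, y⁻¹] → ℂ[y, y⁻¹]`. -/
noncomputable def toComplex : ℤ[T;T⁻¹] →+* ℂ[T;T⁻¹] :=
  AddMonoidAlgebra.mapRingHom ℤ (Int.castRingHom ℂ)

/-- The sum `∑_Q f_Q(y) (1 + y)^(dim Q + d) ∑_{m ∈ Relint(ℓQ) ∩ M} φ(m)`, with `d` in the role of
the degree of `φ`. -/
noncomputable def weightedSum (P : LatticePolytope n) (φ : MvPolynomial (Fin n) ℂ) (d : ℕ)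
    (f : P.Weight) (l : ℕ) : ℂ[T;T⁻¹] :=
  ∑ Q : P.Face, toComplex (f Q) * (1 + LaurentPolynomial.T 1) ^ (Q.dim + d) *
    LaurentPolynomial.C (relintSum φ Q l)

/-- The renormalized sum `∑_Q f_Q(y) (1 + y)^(dim Q) ∑_{m ∈ Relint(ℓQ) ∩ M} φ(m)`. -/
noncomputable def renormalizedSum (P : LatticePolytope n) (φ : MvPolynomial (Fin n) ℂ)
    (f : P.Weight) (l : ℕ) : ℂ[T;T⁻¹] :=
  ∑ Q : P.Face, toComplex (f Q) * (1 + LaurentPolynomial.T 1) ^ Q.dim *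
    LaurentPolynomial.C (relintSum φ Q l)

/-- `E = E(z, y)` is the generalized weighted Ehrhart polynomial of `P`, `φ`, `f`: the polynomial
in `z` with coefficients in `ℂ[y, y⁻¹]` that takes the value `weightedSum P φ d f ℓ` at `z = ℓ` for
all integers `ℓ > 0`. -/
def IsEhrhart (P : LatticePolytope n) (φ : MvPolynomial (Fin n) ℂ) (d : ℕ) (f : P.Weight)
    (E : Polynomial ℂ[T;T⁻¹]) : Prop :=
  ∀ l : ℕ, 0 < l → E.eval (l : ℂ[T;T⁻¹]) = P.weightedSum φ d f l

/-- The same for the renormalized polynomial. -/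
def IsRenormalizedEhrhart (P : LatticePolytope n) (φ : MvPolynomial (Fin n) ℂ) (f : P.Weight)
    (E : Polynomial ℂ[T;T⁻¹]) : Prop :=
  ∀ l : ℕ, 0 < l → E.eval (l : ℂ[T;T⁻¹]) = P.renormalizedSum φ f l

open Classical in
/-- The dual weight vector
`𝔻(f)_Q(y) = ∑_{Q ⪯ E} (1 + y)^(dim E - dim Q) (-y)^(-dim E) f_E(1/y)`; here `dim Q ≤ dim E`,
`(-y)^(-k) = (-y⁻¹)^k`, and `LaurentPolynomial.invert` is the substitution `y ↦ 1/y`. -/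
noncomputable def dualWeight (P : LatticePolytope n) (f : P.Weight) : P.Weight := fun Q =>
  ∑ E : P.Face with Q.pts ⊆ E.pts, (1 + LaurentPolynomial.T 1) ^ (E.dim - Q.dim) *
    (-LaurentPolynomial.T (-1)) ^ E.dim * LaurentPolynomial.invert (f E)

end LatticePolytope

/-! Everything reduces to a reciprocity law for a single face. Let R_Q be the polynomial with R_Q(ℓ)
= ∑ φ(m) over the lattice points m of Relint(ℓQ), ℓ > 0. Then R_Q(-ℓ) = (-1)^(dim Q + d) ∑_{F ⊆ Q}
R_F(ℓ) (`Face.exists_polynomial_relintSum`); for ℓ > 0 the right-hand sum is the sum over ℓQ, since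
the relative interiors of the faces partition Q. Insert this into ∑ f_Q (1+y)^(dim Q + e) R_Q(-ℓ)
and exchange the summations: R_F(ℓ) gets the coefficient (-1)^d ∑_{E ⊇ F} (-1)^(dim E) f_E
(1+y)^(dim E + e). As y(1 + 1/y) = 1 + y, this equals (-1)^d y^e 𝔻(f)_F(1/y) (1 + 1/y)^(dim F + e).
The two claims are e = d and e = 0.

The law for one face is proved on the cone over Q × {1}. A generic weight ω triangulates this cone
into simplicial cones, and a generic interior vector q decides which facets each of them keeps. The
resulting half-open cones are disjoint and fill the closed cone; replacing q by -q exchanges kept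
and removed facets and fills the relative interior (`exists_halfOpen_decomposition`).

In a half-open simplicial cone each lattice point is a point of the half-open parallelepiped plus a
non-negative integral combination of the generators. This leaves sums of a polynomial over tuples of
given total, which are polynomial in the total and become, up to sign, sums over tuples of negative
integers when the total is negative (`exists_polynomial_finsum_tuples`). The map x ↦ -x carries the
latter to the complementary half-open cone and contributes (-1)^d. -/

/-! ### Power sums at positive and negative integers -/

/-- The polynomial with `S(j) = ∑ i ≤ j, i ^ s`, normalized by `S(-1) = 0`. -/
noncomputable def powerSumPoly (s : ℕ) : Polynomial ℂ :=
  Polynomial.C ((s + 1 : ℂ)⁻¹) *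
    (((Polynomial.bernoulli (s + 1)).map (algebraMap ℚ ℂ)).comp (1 + Polynomial.X) -
      Polynomial.C (((Polynomial.bernoulli (s + 1)).map (algebraMap ℚ ℂ)).eval 0))

theorem bernoulli_map_eval_one_add (n : ℕ) (x : ℂ) :
    ((Polynomial.bernoulli n).map (algebraMap ℚ ℂ)).eval (1 + x) =
      ((Polynomial.bernoulli n).map (algebraMap ℚ ℂ)).eval x + n * x ^ (n - 1) := by
  have key : ((Polynomial.bernoulli n).map (algebraMap ℚ ℂ)).comp (1 + Polynomial.X) =
      (Polynomial.bernoulli n).map (algebraMap ℚ ℂ) +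
        Polynomial.C (n : ℂ) * Polynomial.X ^ (n - 1) := by
    have h0 : (Polynomial.bernoulli n).comp (1 + Polynomial.X) =
        Polynomial.bernoulli n + Polynomial.C (n : ℚ) * Polynomial.X ^ (n - 1) := by
      apply Polynomial.funext
      intro r
      simp [Polynomial.bernoulli_eval_one_add]
    have := congrArg (Polynomial.map (algebraMap ℚ ℂ)) h0
    simpa [Polynomial.map_comp] using this
  have := congrArg (Polynomial.eval x) key
  simpa using this

theorem powerSumPoly_eval_sub (s : ℕ) (x : ℂ) :
    (powerSumPoly s).eval (x + 1) = (powerSumPoly s).eval x + (x + 1) ^ s := by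
  have h := bernoulli_map_eval_one_add (s + 1) (1 + x)
  have h1 : (s + 1 : ℂ) ≠ 0 := by exact_mod_cast s.succ_ne_zero
  simp only [powerSumPoly, Polynomial.eval_mul, Polynomial.eval_C, Polynomial.eval_sub,
    Polynomial.eval_comp, Polynomial.eval_add, Polynomial.eval_one, Polynomial.eval_X]
  rw [add_comm x 1, h]
  push_cast
  field_simp
  ring

theorem powerSumPoly_eval_neg_one (s : ℕ) : (powerSumPoly s).eval (-1) = 0 := by
  simp [powerSumPoly]

theorem powerSumPoly_eval_nat (s j : ℕ) :
    (powerSumPoly s).eval (j : ℂ) = ∑ i ∈ Finset.range (j + 1), (i : ℂ) ^ s := by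
  induction j with
  | zero =>
    have := powerSumPoly_eval_sub s (-1)
    rw [powerSumPoly_eval_neg_one] at this
    simpa using this
  | succ j ih =>
    rw [Finset.sum_range_succ, ← ih]
    have := powerSumPoly_eval_sub s j
    push_cast
    exact this

/-- The recursion S(x + 1) = S(x) + (x + 1)^s, run downwards from S(-1) = 0, subtracts the powers of
-1, -2, …; this is the source of all reciprocity signs. -/
theorem powerSumPoly_eval_neg (s j : ℕ) :
    (powerSumPoly s).eval (-((j : ℂ) + 1)) =
      -∑ i ∈ Finset.range j, (-((i : ℂ) + 1)) ^ s := by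
  induction j with
  | zero => simpa using powerSumPoly_eval_neg_one s
  | succ j ih =>
    rw [Finset.sum_range_succ, neg_add (∑ i ∈ Finset.range j, _), ← ih]
    have := powerSumPoly_eval_sub s (-((j : ℂ) + 1 + 1))
    push_cast
    rw [show -((j : ℂ) + 1 + 1) + 1 = -((j : ℂ) + 1) by ring] at this
    rw [this]
    ring

/-! ### Products of generating series and sums over tuples -/

/-- The generating series of the values of a polynomial at `0, 1, 2, …`. -/
noncomputable def nonnegSeries (A : Polynomial ℂ) : PowerSeries ℂ :=
  PowerSeries.mk fun i => A.eval (i : ℂ)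

/-- The generating series of the values of a polynomial at `-1, -2, …`. -/
noncomputable def negSeries (A : Polynomial ℂ) : PowerSeries ℂ :=
  PowerSeries.mk fun i => if i = 0 then 0 else A.eval (-(i : ℂ))

/-- Summation of a bivariate polynomial `H(i, j)` over its first variable. -/
theorem exists_polynomial_sum (H : Polynomial (Polynomial ℂ)) :
    ∃ C : Polynomial ℂ,
      (∀ j : ℕ, C.eval (j : ℂ) = ∑ i ∈ Finset.range (j + 1),
        (H.eval (Polynomial.C (i : ℂ))).eval (j : ℂ)) ∧
      (∀ j : ℕ, C.eval (-((j : ℂ) + 1)) = -∑ i ∈ Finset.range j,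
        (H.eval (Polynomial.C (-((i : ℂ) + 1)))).eval (-((j : ℂ) + 1))) := by
  -- Expand H in powers i^k, with coefficients polynomial in j, and replace i^k by its power sum.
  refine ⟨∑ k ∈ H.support, H.coeff k * powerSumPoly k, fun j => ?_, fun j => ?_⟩
  · simp only [Polynomial.eval_finsetSum, Polynomial.eval_mul, powerSumPoly_eval_nat,
      Finset.mul_sum, Polynomial.eval_eq_sum (p := H), Polynomial.sum]
    rw [Finset.sum_comm]
    simp
  · simp only [Polynomial.eval_finsetSum, Polynomial.eval_mul, powerSumPoly_eval_neg,
      Finset.mul_sum, Polynomial.eval_eq_sum (p := H), Polynomial.sum, mul_neg,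
      Finset.sum_neg_distrib]
    rw [Finset.sum_comm]
    simp

/-- The coefficients are the convolutions ∑ A(i) B(j - i), so bivariate summation makes them
polynomial in j. The same polynomial at -j gives the convolution over negative arguments with the
opposite sign. -/
theorem exists_polynomial_series_mul (A B : Polynomial ℂ) :
    ∃ C : Polynomial ℂ, nonnegSeries A * nonnegSeries B = nonnegSeries C ∧
      negSeries A * negSeries B = -negSeries C := by
  obtain ⟨C, h1, h2⟩ := exists_polynomial_sum
    (A.map Polynomial.C * (B.map Polynomial.C).comp (Polynomial.C Polynomial.X - Polynomial.X))
  have hev : ∀ a b : ℂ, (Polynomial.eval (Polynomial.C a) (A.map Polynomial.C *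
      (B.map Polynomial.C).comp (Polynomial.C Polynomial.X - Polynomial.X))).eval b =
      A.eval a * B.eval (b - a) := by
    intro a b
    simp only [Polynomial.eval_mul, Polynomial.eval_comp, Polynomial.eval_sub, Polynomial.eval_C,
      Polynomial.eval_X, Polynomial.eval_map]
    congr 1
    · rw [Polynomial.eval₂_at_apply, Polynomial.eval_C]
    · rw [← Polynomial.comp, Polynomial.eval_comp]
      simp
  simp only [hev] at h1 h2
  refine ⟨C, ?_, ?_⟩
  · ext j
    rw [PowerSeries.coeff_mul, Finset.Nat.sum_antidiagonal_eq_sum_range_succ_mk]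
    simp only [nonnegSeries, PowerSeries.coeff_mk, h1]
    refine Finset.sum_congr rfl fun i hi => ?_
    rw [Nat.cast_sub (by simpa [Nat.lt_succ_iff] using hi)]
  · ext j
    rw [PowerSeries.coeff_mul, Finset.Nat.sum_antidiagonal_eq_sum_range_succ_mk]
    simp only [negSeries, PowerSeries.coeff_mk, map_neg]
    rcases j with _ | j
    · simp
    -- Both end terms vanish because `negSeries` has constant term 0.
    · rw [Finset.sum_range_succ, Finset.sum_range_succ']
      have := h2 j
      simp only [Nat.succ_ne_zero, if_false, Nat.cast_succ, if_true, zero_mul, add_zero,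
        Nat.sub_self, mul_zero, this, neg_neg]
      refine Finset.sum_congr rfl fun i hi => ?_
      have hi' : i < j := by simpa using hi
      rw [if_neg (by omega), Nat.cast_sub (by omega)]
      push_cast
      congr 2
      ring

/-- One sign for each of the `s.card - 1` multiplications. The empty product 1 has coefficients 1,
0, 0, …, which are not the values of a polynomial, so `s` must be non-empty. -/
theorem exists_polynomial_series_prod {κ : Type*} (s : Finset κ) (hs : s.Nonempty)
    (A : κ → Polynomial ℂ) :
    ∃ C : Polynomial ℂ, ∏ u ∈ s, nonnegSeries (A u) = nonnegSeries C ∧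
      ∏ u ∈ s, negSeries (A u) = (-1) ^ (s.card + 1) * negSeries C := by
  classical
  induction hs using Finset.Nonempty.cons_induction with
  | singleton a => exact ⟨A a, by simp⟩
  | cons a s ha hs ih =>
    obtain ⟨C, h1, h2⟩ := ih
    obtain ⟨D, h3, h4⟩ := exists_polynomial_series_mul (A a) C
    refine ⟨D, by rw [Finset.prod_cons, h1, h3], ?_⟩
    rw [Finset.prod_cons, h2, mul_left_comm, h4, Finset.card_cons]
    ring

theorem exists_polynomial_sum_monomial {κ : Type*} [Fintype κ] [DecidableEq κ] [Nonempty κ]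
    (A : κ → Polynomial ℂ) :
    ∃ C : Polynomial ℂ,
      (∀ j : ℕ, C.eval (j : ℂ) = ∑ n ∈ Finset.finsuppAntidiag (Finset.univ : Finset κ) j,
        ∏ u, (A u).eval (n u : ℂ)) ∧
      (∀ j : ℕ, 0 < j → C.eval (-(j : ℂ)) = (-1) ^ (Fintype.card κ + 1) *
        ∑ n ∈ Finset.finsuppAntidiag (Finset.univ : Finset κ) j with ∀ u, n u ≠ 0,
          ∏ u, (A u).eval (-(n u : ℂ))) := by
  obtain ⟨C, h1, h2⟩ := exists_polynomial_series_prod Finset.univ Finset.univ_nonempty A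
  refine ⟨C, fun j => ?_, fun j hj => ?_⟩
  · have := congrArg (PowerSeries.coeff j) h1
    rw [PowerSeries.coeff_prod] at this
    simpa [nonnegSeries] using this.symm
  · have hsgn : negSeries C = (-1) ^ (Fintype.card κ + 1) * ∏ u, negSeries (A u) := by
      rw [h2, ← mul_assoc, ← Finset.card_univ, ← mul_pow]
      simp
    have := congrArg (PowerSeries.coeff j) hsgn
    have hC : (-1 : PowerSeries ℂ) ^ (Fintype.card κ + 1) =
        PowerSeries.C ((-1 : ℂ) ^ (Fintype.card κ + 1)) := by simp
    rw [hC, PowerSeries.coeff_C_mul, PowerSeries.coeff_prod] at this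
    simp only [negSeries, PowerSeries.coeff_mk, if_neg hj.ne'] at this
    rw [this, Finset.sum_filter]
    congr 1
    refine Finset.sum_congr rfl fun n _ => ?_
    split_ifs with h
    · exact Finset.prod_congr rfl fun u _ => by rw [if_neg (h u)]
    · push Not at h
      obtain ⟨u, hu⟩ := h
      exact Finset.prod_eq_zero (Finset.mem_univ u) (by rw [if_pos hu])

/-- Both identities are linear in g, and on a monomial the summand factors over the coordinates,
which is the product case. -/
theorem exists_polynomial_sum_mvPolynomial {κ : Type*} [Fintype κ] [DecidableEq κ] [Nonempty κ]
    (g : MvPolynomial κ ℂ) :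
    ∃ C : Polynomial ℂ,
      (∀ j : ℕ, C.eval (j : ℂ) = ∑ n ∈ Finset.finsuppAntidiag (Finset.univ : Finset κ) j,
        MvPolynomial.eval (fun u => (n u : ℂ)) g) ∧
      (∀ j : ℕ, 0 < j → C.eval (-(j : ℂ)) = (-1) ^ (Fintype.card κ + 1) *
        ∑ n ∈ Finset.finsuppAntidiag (Finset.univ : Finset κ) j with ∀ u, n u ≠ 0,
          MvPolynomial.eval (fun u => -(n u : ℂ)) g) := by
  induction g using MvPolynomial.induction_on' with
  | monomial m a =>
    obtain ⟨C, h1, h2⟩ := exists_polynomial_sum_monomial fun u : κ => Polynomial.X ^ (m u)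
    refine ⟨Polynomial.C a * C, fun j => ?_, fun j hj => ?_⟩
    · simp [h1, MvPolynomial.eval_monomial, Finsupp.prod_fintype, Finset.mul_sum]
    · rw [Polynomial.eval_mul, h2 j hj, Polynomial.eval_C, mul_left_comm, Finset.mul_sum]
      simp [MvPolynomial.eval_monomial, Finsupp.prod_fintype]
  | add p q hp hq =>
    obtain ⟨C, h1, h2⟩ := hp
    obtain ⟨D, h3, h4⟩ := hq
    refine ⟨C + D, fun j => ?_, fun j hj => ?_⟩
    · simp [h1, h3, Finset.sum_add_distrib]
    · rw [Polynomial.eval_add, h2 j hj, h4 j hj]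
      simp [Finset.sum_add_distrib, mul_add]

/-- Tuples of non-negative integers with a given sum. -/
def nonnegTuples (κ : Type*) [Fintype κ] (j : ℤ) : Set (κ → ℤ) :=
  {n | (∀ u, 0 ≤ n u) ∧ ∑ u, n u = j}

/-- Tuples of negative integers with a given sum. -/
def negTuples (κ : Type*) [Fintype κ] (j : ℤ) : Set (κ → ℤ) :=
  {n | (∀ u, n u < 0) ∧ ∑ u, n u = j}

theorem finsum_nonnegTuples {κ : Type*} [Fintype κ] [DecidableEq κ] (h : (κ → ℤ) → ℂ) (j : ℕ) :
    ∑ᶠ n ∈ nonnegTuples κ j, h n =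
      ∑ n ∈ Finset.finsuppAntidiag (Finset.univ : Finset κ) j, h fun u => (n u : ℤ) := by
  have hinj : Set.InjOn (fun (n : κ →₀ ℕ) (u : κ) => (n u : ℤ))
      (Finset.finsuppAntidiag (Finset.univ : Finset κ) j : Set (κ →₀ ℕ)) := by
    intro a _ b _ hab
    ext u
    have := congrFun hab u
    simp only at this
    exact_mod_cast this
  rw [← Finset.sum_image (g := fun (n : κ →₀ ℕ) (u : κ) => (n u : ℤ)) (f := h) hinj,
    ← finsum_mem_coe_finset]
  refine finsum_mem_congr (Set.ext fun n => ?_) fun _ _ => rfl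
  simp only [nonnegTuples, Set.mem_ofPred_eq, Finset.coe_image, Set.mem_image, Finset.mem_coe,
    Finset.mem_finsuppAntidiag, Finset.subset_univ, and_true]
  constructor
  · rintro ⟨h0, hs⟩
    refine ⟨Finsupp.equivFunOnFinite.symm fun u => (n u).toNat, ?_, ?_⟩
    · zify
      rw [← hs]
      exact Finset.sum_congr rfl fun u _ => by simp [h0 u]
    · ext u
      simp [h0 u]
  · rintro ⟨m, hm, rfl⟩
    refine ⟨fun u => by positivity, ?_⟩
    rw [← hm]
    push_cast
    rfl

theorem finsum_negTuples {κ : Type*} [Fintype κ] [DecidableEq κ] (h : (κ → ℤ) → ℂ) (j : ℕ) :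
    ∑ᶠ n ∈ negTuples κ (-j), h n =
      ∑ n ∈ Finset.finsuppAntidiag (Finset.univ : Finset κ) j with ∀ u, n u ≠ 0,
        h fun u => -(n u : ℤ) := by
  have hinj : Set.InjOn (fun (n : κ →₀ ℕ) (u : κ) => -(n u : ℤ))
      ((Finset.finsuppAntidiag (Finset.univ : Finset κ) j).filter fun n => ∀ u, n u ≠ 0 :
        Finset (κ →₀ ℕ)) := by
    intro a _ b _ hab
    ext u
    have := congrFun hab u
    simp only [neg_inj] at this
    exact_mod_cast this
  rw [← Finset.sum_image (g := fun (n : κ →₀ ℕ) (u : κ) => -(n u : ℤ)) (f := h) hinj,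
    ← finsum_mem_coe_finset]
  refine finsum_mem_congr (Set.ext fun n => ?_) fun _ _ => rfl
  simp only [negTuples, Set.mem_ofPred_eq, Finset.coe_image, Set.mem_image, Finset.mem_coe,
    Finset.mem_finsuppAntidiag, Finset.subset_univ, and_true, Finset.mem_filter]
  constructor
  · rintro ⟨h0, hs⟩
    refine ⟨Finsupp.equivFunOnFinite.symm fun u => (-n u).toNat, ⟨?_, fun u => ?_⟩, ?_⟩
    · zify
      rw [← neg_inj, ← hs, ← Finset.sum_neg_distrib]
      exact Finset.sum_congr rfl fun u _ => by simp [(h0 u).le]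
    · have := h0 u
      simp only [Finsupp.equivFunOnFinite_symm_apply_apply]
      omega
    · ext u
      simp [(h0 u).le]
  · rintro ⟨m, ⟨hm, h0⟩, rfl⟩
    refine ⟨fun u => ?_, ?_⟩
    · have := h0 u
      simp only
      omega
    · rw [← hm]
      push_cast
      rw [Finset.sum_neg_distrib]

theorem nonnegTuples_finite {κ : Type*} [Fintype κ] (j : ℤ) : (nonnegTuples κ j).Finite := by
  classical
  refine (Set.finite_Icc (0 : κ → ℤ) fun _ => j).subset ?_
  rintro n ⟨h0, hs⟩
  refine ⟨h0, fun u => ?_⟩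
  rw [← hs]
  exact Finset.single_le_sum (fun u _ => h0 u) (Finset.mem_univ u)

theorem negTuples_finite {κ : Type*} [Fintype κ] (j : ℤ) : (negTuples κ j).Finite := by
  refine ((nonnegTuples_finite (κ := κ) (-j)).preimage (f := Neg.neg)
    neg_injective.injOn).subset ?_
  rintro n ⟨h0, hs⟩
  exact ⟨fun u => by simpa using (h0 u).le, by simp [hs]⟩

/-- Reciprocity for sums of a polynomial over the lattice points of dilated standard simplices. -/
theorem exists_polynomial_finsum_tuples {κ : Type*} [Fintype κ] [Nonempty κ]
    (g : MvPolynomial κ ℂ) :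
    ∃ C : Polynomial ℂ,
      (∀ j : ℤ, -(Fintype.card κ : ℤ) < j → C.eval (j : ℂ) =
        ∑ᶠ n ∈ nonnegTuples κ j, MvPolynomial.eval (fun u => (n u : ℂ)) g) ∧
      (∀ j : ℤ, j < 0 → C.eval (j : ℂ) = (-1) ^ (Fintype.card κ + 1) *
        ∑ᶠ n ∈ negTuples κ j, MvPolynomial.eval (fun u => (n u : ℂ)) g) := by
  classical
  obtain ⟨C, h1, h2⟩ := exists_polynomial_sum_mvPolynomial g
  have h3 : ∀ j : ℤ, j < 0 → C.eval (j : ℂ) = (-1) ^ (Fintype.card κ + 1) *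
      ∑ᶠ n ∈ negTuples κ j, MvPolynomial.eval (fun u => (n u : ℂ)) g := by
    intro j hj
    obtain ⟨k, rfl⟩ : ∃ k : ℕ, j = -(k : ℤ) := ⟨(-j).toNat, by omega⟩
    rw [finsum_negTuples (fun n => MvPolynomial.eval (fun u => (n u : ℂ)) g)]
    have := h2 k (by omega)
    push_cast
    exact this
  refine ⟨C, fun j hj => ?_, h3⟩
  by_cases hj0 : 0 ≤ j
  · lift j to ℕ using hj0
    rw [finsum_nonnegTuples (fun n => MvPolynomial.eval (fun u => (n u : ℂ)) g)]
    have := h1 j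
    push_cast
    exact this
  -- For -card κ < j < 0 both sums are empty: negative entries total at most -card κ, non-negative
  -- ones at least 0.
  · push Not at hj0
    rw [h3 j hj0]
    have e1 : negTuples κ j = ∅ := by
      rw [Set.eq_empty_iff_forall_notMem]
      rintro n ⟨hn, hs⟩
      have : ∑ u, n u ≤ ∑ _u : κ, (-1 : ℤ) :=
        Finset.sum_le_sum fun u _ => by have := hn u; omega
      simp at this
      omega
    have e2 : nonnegTuples κ j = ∅ := by
      rw [Set.eq_empty_iff_forall_notMem]
      rintro n ⟨hn, hs⟩
      have := Finset.sum_nonneg fun u (_ : u ∈ Finset.univ) => hn u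
      omega
    simp [e1, e2]

/-! ### Half-open simplicial cones -/

open Classical in
/-- The integral part with remainder in `(0, 1]` if `u ∈ S`, and in `[0, 1)` otherwise. -/
noncomputable def halfOpenFloor {κ : Type*} (S : Set κ) (u : κ) (r : ℝ) : ℤ :=
  if u ∈ S then ⌈r⌉ - 1 else ⌊r⌋

theorem halfOpenFloor_add_intCast {κ : Type*} (S : Set κ) (u : κ) (r : ℝ) (k : ℤ) :
    halfOpenFloor S u (r + k) = halfOpenFloor S u r + k := by
  unfold halfOpenFloor
  split_ifs
  · rw [Int.ceil_add_intCast]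
    ring
  · rw [Int.floor_add_intCast]

theorem halfOpenFloor_nonneg_iff {κ : Type*} (S : Set κ) (u : κ) (r : ℝ) :
    0 ≤ halfOpenFloor S u r ↔ (u ∈ S → 0 < r) ∧ (u ∉ S → 0 ≤ r) := by
  unfold halfOpenFloor
  split_ifs with h
  · simp only [h, true_imp_iff, not_true_eq_false, false_imp_iff, and_true]
    rw [sub_nonneg, Int.one_le_ceil_iff]
  · simp only [h, true_imp_iff, not_false_eq_true, false_imp_iff, true_and]
    exact Int.floor_nonneg

/-- Negation exchanges strict and weak inequalities, hence S and its complement. -/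
theorem halfOpenFloor_neg_iff {κ : Type*} (S : Set κ) (u : κ) (r : ℝ) :
    halfOpenFloor S u (-r) < 0 ↔ (u ∈ Sᶜ → 0 < r) ∧ (u ∉ Sᶜ → 0 ≤ r) := by
  rw [← not_le, halfOpenFloor_nonneg_iff]
  by_cases h : u ∈ S <;> simp [h]

theorem halfOpenFloor_eq_zero_bounds {κ : Type*} {S : Set κ} {u : κ} {r : ℝ}
    (h : halfOpenFloor S u r = 0) : 0 ≤ r ∧ r ≤ 1 := by
  unfold halfOpenFloor at h
  split_ifs at h
  · rw [sub_eq_zero, Int.ceil_eq_iff] at h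
    push_cast at h
    exact ⟨by linarith [h.1], h.2⟩
  · rw [Int.floor_eq_zero_iff] at h
    exact ⟨h.1, h.2.le⟩

section HalfOpenCone

variable {Λ κ : Type*} [AddCommGroup Λ]

/-- The points with non-negative coordinates, those in `S` being positive. -/
def halfOpenCone (c : Λ →+ (κ → ℝ)) (S : Set κ) : Set Λ :=
  {x | ∀ u, (u ∈ S → 0 < c x u) ∧ (u ∉ S → 0 ≤ c x u)}

/-- The half-open fundamental parallelepiped. -/
def halfOpenBox (c : Λ →+ (κ → ℝ)) (S : Set κ) : Set Λ :=
  {x | ∀ u, halfOpenFloor S u (c x u) = 0}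

theorem halfOpenBox_finite {c : Λ →+ (κ → ℝ)}
    (hfin : ∀ R : ℝ, {x | ∀ u, |c x u| ≤ R}.Finite) (S : Set κ) : (halfOpenBox c S).Finite := by
  refine (hfin 1).subset fun x hx u => ?_
  have := halfOpenFloor_eq_zero_bounds (hx u)
  rw [abs_le]
  exact ⟨by linarith, this.2⟩

variable [Fintype κ]

theorem halfOpenCone_slice_finite {c : Λ →+ (κ → ℝ)} {ht : Λ →+ ℤ}
    (hht : ∀ x, (ht x : ℝ) = ∑ u, c x u) (hfin : ∀ R : ℝ, {x | ∀ u, |c x u| ≤ R}.Finite)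
    (S : Set κ) (l : ℤ) : {x | x ∈ halfOpenCone c S ∧ ht x = l}.Finite := by
  refine (hfin l).subset ?_
  rintro x ⟨hx, rfl⟩ u
  have hnn : ∀ u, 0 ≤ c x u := fun u => by
    by_cases hu : u ∈ S
    · exact ((hx u).1 hu).le
    · exact (hx u).2 hu
  rw [abs_of_nonneg (hnn u), hht]
  exact Finset.single_le_sum (fun u _ => hnn u) (Finset.mem_univ u)

variable [DecidableEq κ]

theorem coord_add_sum_zsmul {c : Λ →+ (κ → ℝ)} {w : κ → Λ} (hw : ∀ u, c (w u) = Pi.single u 1)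
    (p : Λ) (n : κ → ℤ) (u : κ) : c (p + ∑ i, n i • w i) u = c p u + n u := by
  simp [hw, Finset.sum_apply, Pi.single_apply]

theorem height_add_sum_zsmul {c : Λ →+ (κ → ℝ)} {w : κ → Λ} (hw : ∀ u, c (w u) = Pi.single u 1)
    {ht : Λ →+ ℤ} (hht : ∀ x, (ht x : ℝ) = ∑ u, c x u) (p : Λ) (n : κ → ℤ) :
    ht (p + ∑ i, n i • w i) = ht p + ∑ u, n u := by
  have : (ht (p + ∑ i, n i • w i) : ℝ) = ht p + ∑ u, (n u : ℝ) := by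
    rw [hht, hht, ← Finset.sum_add_distrib]
    exact Finset.sum_congr rfl fun u _ => coord_add_sum_zsmul hw p n u
  exact_mod_cast this

/-- Summation over lattice points by translating the fundamental parallelepiped. -/
theorem finsum_eq_sum_halfOpenBox {c : Λ →+ (κ → ℝ)} {w : κ → Λ}
    (hw : ∀ u, c (w u) = Pi.single u 1) {ht : Λ →+ ℤ} (hht : ∀ x, (ht x : ℝ) = ∑ u, c x u)
    (hfin : ∀ R : ℝ, {x | ∀ u, |c x u| ≤ R}.Finite) (S : Set κ) (φ : Λ → ℂ)
    (D : (κ → ℤ) → Prop) (hD : ∀ j : ℤ, {n : κ → ℤ | D n ∧ ∑ u, n u = j}.Finite) (j : ℤ) :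
    ∑ᶠ y ∈ {y | (D fun u => halfOpenFloor S u (c y u)) ∧ ht y = j}, φ y =
      ∑ p ∈ (halfOpenBox_finite hfin S).toFinset,
        ∑ᶠ n ∈ {n : κ → ℤ | D n ∧ ∑ u, n u = j - ht p}, φ (p + ∑ u, n u • w u) := by
  have hfl : ∀ p ∈ halfOpenBox c S, ∀ n : κ → ℤ,
      (fun u => halfOpenFloor S u (c (p + ∑ i, n i • w i) u)) = n := by
    intro p hp n
    ext u
    rw [coord_add_sum_zsmul hw, halfOpenFloor_add_intCast, hp u, zero_add]
  -- Each y is p + ∑ n u • w u for a unique p in the box and unique n, namely the half-open floors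
  -- of its coordinates.
  have hset : {y | (D fun u => halfOpenFloor S u (c y u)) ∧ ht y = j} =
      ⋃ p ∈ halfOpenBox c S, (fun n : κ → ℤ => p + ∑ u, n u • w u) ''
        {n : κ → ℤ | D n ∧ ∑ u, n u = j - ht p} := by
    ext y
    simp only [Set.mem_ofPred_eq, Set.mem_iUnion, Set.mem_image, exists_prop]
    constructor
    · rintro ⟨hDy, hy⟩
      set n : κ → ℤ := fun u => halfOpenFloor S u (c y u) with hn
      have hy' : y - ∑ u, n u • w u + ∑ u, n u • w u = y := by abel
      refine ⟨y - ∑ u, n u • w u, fun u => ?_, n, ⟨hDy, ?_⟩, hy'⟩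
      · have h1 := coord_add_sum_zsmul hw y (fun u => -n u) u
        simp only [neg_smul, Finset.sum_neg_distrib, ← sub_eq_add_neg] at h1
        rw [h1, halfOpenFloor_add_intCast, hn]
        ring
      · have h1 := height_add_sum_zsmul hw hht (y - ∑ u, n u • w u) n
        rw [hy', hy] at h1
        omega
    · rintro ⟨p, hp, n, ⟨hDn, hn⟩, rfl⟩
      refine ⟨?_, ?_⟩
      · rw [hfl p hp n]
        exact hDn
      · rw [height_add_sum_zsmul hw hht]
        omega
  rw [hset, finsum_mem_biUnion ?_ (halfOpenBox_finite hfin S) fun p _ => (hD _).image _,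
    finsum_mem_eq_finite_toFinset_sum _ (halfOpenBox_finite hfin S)]
  · refine Finset.sum_congr rfl fun p hp => finsum_mem_image ?_
    have hp' : p ∈ halfOpenBox c S := by simpa using hp
    intro n _ m _ hnm
    have hnm' : p + ∑ u, n u • w u = p + ∑ u, m u • w u := hnm
    rw [← hfl p hp' n, hnm', hfl p hp' m]
  · intro p hp q hq hpq
    rw [Function.onFun, Set.disjoint_left]
    rintro _ ⟨n, _, rfl⟩ ⟨m, _, hm⟩
    have hm' : q + ∑ u, m u • w u = p + ∑ u, n u • w u := hm
    have : m = n := by rw [← hfl q hq m, hm', hfl p hp n]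
    subst this
    exact hpq (add_right_cancel hm').symm

/-- Reciprocity for half-open simplicial cones. -/
theorem exists_polynomial_halfOpenCone [Nonempty κ] {c : Λ →+ (κ → ℝ)} {w : κ → Λ}
    (hw : ∀ u, c (w u) = Pi.single u 1) {ht : Λ →+ ℤ} (hht : ∀ x, (ht x : ℝ) = ∑ u, c x u)
    (hfin : ∀ R : ℝ, {x | ∀ u, |c x u| ≤ R}.Finite) {φ : Λ → ℂ} {d : ℕ}
    (hφ : ∀ x, φ (-x) = (-1) ^ d * φ x)
    (hpoly : ∀ p, ∃ g : MvPolynomial κ ℂ, ∀ n : κ → ℤ,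
      φ (p + ∑ u, n u • w u) = MvPolynomial.eval (fun u => (n u : ℂ)) g) (S : Set κ) :
    ∃ C : Polynomial ℂ, ∀ l : ℤ, 0 < l →
      C.eval (l : ℂ) = ∑ᶠ x ∈ {x | x ∈ halfOpenCone c S ∧ ht x = l}, φ x ∧
      C.eval (-(l : ℂ)) = (-1) ^ (Fintype.card κ + 1 + d) *
        ∑ᶠ x ∈ {x | x ∈ halfOpenCone c Sᶜ ∧ ht x = l}, φ x := by
  choose g hg using hpoly
  choose G hG1 hG2 using fun p => exists_polynomial_finsum_tuples (g p)
  set B := (halfOpenBox_finite hfin S).toFinset with hB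
  -- These bounds give l - ht p > -card κ and -l - ht p < 0 for l > 0, exactly the ranges in which
  -- the two tuple formulas hold.
  have hbox : ∀ p ∈ B, 0 ≤ ht p ∧ ht p ≤ Fintype.card κ := by
    intro p hp
    have hp' : p ∈ halfOpenBox c S := by simpa [hB] using hp
    have hb := fun u => halfOpenFloor_eq_zero_bounds (hp' u)
    constructor
    · have : (0 : ℝ) ≤ ht p := by
        rw [hht]
        exact Finset.sum_nonneg fun u _ => (hb u).1
      exact_mod_cast this
    · have : (ht p : ℝ) ≤ ∑ _u : κ, (1 : ℝ) := by
        rw [hht]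
        exact Finset.sum_le_sum fun u _ => (hb u).2
      simp only [Finset.sum_const, Finset.card_univ, nsmul_eq_mul, mul_one] at this
      exact_mod_cast this
  refine ⟨∑ p ∈ B, (G p).comp (Polynomial.X - Polynomial.C (ht p : ℂ)), fun l hl => ⟨?_, ?_⟩⟩
  · have h1 := finsum_eq_sum_halfOpenBox hw hht hfin S φ (fun n => ∀ u, 0 ≤ n u)
      nonnegTuples_finite l
    simp only [halfOpenFloor_nonneg_iff] at h1
    refine Eq.trans ?_ h1.symm
    rw [Polynomial.eval_finsetSum]
    refine Finset.sum_congr rfl fun p hp => ?_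
    have h2 := hG1 p (l - ht p) (by have := hbox p hp; omega)
    simp only [hg]
    simp only [Polynomial.eval_comp, Polynomial.eval_sub, Polynomial.eval_X, Polynomial.eval_C]
    push_cast at h2
    exact h2
  · have h1 := finsum_eq_sum_halfOpenBox hw hht hfin S φ (fun n => ∀ u, n u < 0)
      negTuples_finite (-l)
    -- Reflection in the origin carries the complementary half-open cone to the points all of whose
    -- S-floors are negative.
    have h3 : ∑ᶠ x ∈ {x | x ∈ halfOpenCone c Sᶜ ∧ ht x = l}, φ x = (-1) ^ d *
        ∑ᶠ y ∈ {y | (∀ u, halfOpenFloor S u (c y u) < 0) ∧ ht y = -l}, φ y := by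
      rw [mul_finsum_mem]
      have himg : {x | x ∈ halfOpenCone c Sᶜ ∧ ht x = l} =
          Neg.neg '' {y | (∀ u, halfOpenFloor S u (c y u) < 0) ∧ ht y = -l} := by
        rw [Set.image_neg_eq_neg]
        ext x
        simp only [Set.mem_neg, Set.mem_ofPred_eq, map_neg, Pi.neg_apply, neg_inj,
          halfOpenFloor_neg_iff, halfOpenCone]
      rw [himg, finsum_mem_image neg_injective.injOn]
      exact finsum_mem_congr rfl fun y _ => hφ y
    rw [h3, h1, Polynomial.eval_finsetSum, ← mul_assoc, pow_add, mul_assoc ((-1 : ℂ) ^ _),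
      ← pow_add, ← two_mul, pow_mul, neg_one_sq, one_pow, mul_one, Finset.mul_sum]
    refine Finset.sum_congr rfl fun p hp => ?_
    have h2 := hG2 p (-l - ht p) (by have := hbox p hp; omega)
    simp only [hg]
    simp only [Polynomial.eval_comp, Polynomial.eval_sub, Polynomial.eval_X, Polynomial.eval_C]
    push_cast at h2
    exact h2

end HalfOpenCone

/-! ### Regular triangulations and half-open decompositions -/

/-- A strictly positive vector off finitely many hyperplanes. -/
theorem exists_pos_dotProduct_ne_zero {ι J : Type*} [Fintype ι] [Finite J] (f : J → ι → ℝ)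
    (hf : ∀ j, f j ≠ 0) : ∃ t : ι → ℝ, (∀ i, 0 < t i) ∧ ∀ j, ∑ i, f j i * t i ≠ 0 := by
  classical
  cases nonempty_fintype J
  let e := Fintype.equivFin ι
  -- On the moment curve i ↦ s^i each hyperplane becomes a nonzero polynomial in s, so some s > 0
  -- avoids all roots.
  let p : J → Polynomial ℝ := fun j => ∑ i, Polynomial.monomial (e i : ℕ) (f j i)
  have hp : ∀ j, p j ≠ 0 := by
    intro j h0
    apply hf j
    ext i
    have h1 := congrArg (fun r : Polynomial ℝ => r.coeff (e i)) h0
    simpa [p, Polynomial.finsetSum_coeff, Polynomial.coeff_monomial, Fin.val_inj,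
      Finset.sum_ite_eq'] using h1
  have hprod : ∏ j, p j ≠ 0 := Finset.prod_ne_zero_iff.2 fun j _ => hp j
  obtain ⟨s, hs0, hs⟩ : ∃ s : ℝ, 0 < s ∧ ¬ (∏ j, p j).IsRoot s := by
    by_contra! h
    exact hprod (Polynomial.eq_zero_of_infinite_isRoot _
      ((Set.Ioi_infinite (0 : ℝ)).mono fun s hs => h s hs))
  refine ⟨fun i => s ^ (e i : ℕ), fun i => pow_pos hs0 _, fun j h0 => hs ?_⟩
  rw [Polynomial.IsRoot, Polynomial.eval_prod]
  refine Finset.prod_eq_zero (Finset.mem_univ j) ?_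
  simpa [p, Polynomial.eval_finsetSum] using h0

/-- Moving from a non-negative vector along `-μ` until a coordinate vanishes. -/
theorem exists_sub_smul_nonneg {ι : Type*} [Fintype ι] {a μ : ι → ℝ} (ha : 0 ≤ a)
    (hμ : ∃ i, 0 < μ i) :
    ∃ t : ℝ, 0 ≤ t ∧ 0 ≤ a - t • μ ∧ ∃ i, 0 < μ i ∧ (a - t • μ) i = 0 := by
  classical
  obtain ⟨i, hi⟩ := hμ
  -- Ratio test of the simplex method: the smallest a i / μ i with μ i > 0 is the first time a
  -- coordinate reaches 0.
  obtain ⟨k, hk, hmin⟩ := Finset.exists_min_image (Finset.univ.filter fun i => 0 < μ i)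
    (fun i => a i / μ i) ⟨i, by simpa using hi⟩
  have hk' : 0 < μ k := by simpa using hk
  refine ⟨a k / μ k, div_nonneg (ha k) hk'.le, fun j => ?_, k, hk', ?_⟩
  · simp only [Pi.zero_apply, Pi.sub_apply, Pi.smul_apply, smul_eq_mul, sub_nonneg]
    by_cases hj : 0 < μ j
    · exact (le_div_iff₀ hj).1 (hmin j (by simpa using hj))
    · exact (mul_nonpos_of_nonneg_of_nonpos (div_nonneg (ha k) hk'.le) (not_lt.1 hj)).trans (ha j)
  · simp [div_mul_cancel₀ _ hk'.ne']

theorem sum_eq_sum_subtype {ι M : Type*} [Fintype ι] [AddCommMonoid M] {q : ι → Prop}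
    [Fintype {i // q i}] {f : ι → M} (hf : ∀ i, ¬ q i → f i = 0) :
    ∑ i, f i = ∑ i : {i // q i}, f i := by
  classical
  rw [← Finset.sum_subset (Finset.subset_univ (Finset.univ.filter q))
    fun i _ hi => hf i (by simpa using hi)]
  exact Finset.sum_subtype _ (by simp) f

section Triangulation

variable {ι E : Type*} [NormedAddCommGroup E] [NormedSpace ℝ E] {w : ι → E}

/-- The subfamilies of `w` that form a basis. -/
abbrev BasisSet (w : ι → E) : Type _ :=
  {σ : Set ι // LinearIndepOn ℝ w σ ∧ ⊤ ≤ Submodule.span ℝ (w '' σ)}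

namespace BasisSet

/-- The basis formed by a subfamily. -/
noncomputable def basis (σ : BasisSet w) : Module.Basis σ.1 ℝ E :=
  Module.Basis.mk σ.2.1 (by rw [← Set.image_eq_range]; exact σ.2.2)

@[simp]
theorem basis_apply (σ : BasisSet w) (u : σ.1) : σ.basis u = w u :=
  Module.Basis.mk_apply σ.2.1 _ u

variable [Fintype ι]

noncomputable instance (σ : BasisSet w) : Fintype σ.1 := Fintype.ofFinite _

/-- The coordinates with respect to a basis. -/
noncomputable def coord (σ : BasisSet w) : E →ₗ[ℝ] σ.1 → ℝ := σ.basis.equivFun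

theorem sum_coord_smul (σ : BasisSet w) (x : E) : ∑ u, σ.coord x u • w u = x := by
  have := σ.basis.sum_equivFun x
  simp only [basis_apply] at this
  exact this

theorem coord_sum (σ : BasisSet w) (a : σ.1 → ℝ) : σ.coord (∑ u, a u • w u) = a := by
  have := σ.basis.equivFun_symm_apply a
  simp only [basis_apply] at this
  rw [← this]
  exact σ.basis.equivFun.apply_symm_apply a

theorem coord_apply_self (σ : BasisSet w) [DecidableEq σ.1] (u : σ.1) :
    σ.coord (w u) = Pi.single u 1 := by
  ext v
  have := σ.basis.equivFun_self u v
  rw [basis_apply] at this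
  refine this.trans ?_
  simp [Pi.single_apply, eq_comm]

theorem sum_eq_sum_coe {M : Type*} [AddCommMonoid M] (σ : BasisSet w) {f : ι → M}
    (hf : ∀ i ∉ σ.1, f i = 0) : ∑ i, f i = ∑ u : σ.1, f u :=
  sum_eq_sum_subtype hf

/-- The linear functional with prescribed values on a basis. -/
noncomputable def interp (σ : BasisSet w) (ω : ι → ℝ) : E →ₗ[ℝ] ℝ :=
  σ.basis.constr ℝ fun u => ω u

theorem interp_apply (σ : BasisSet w) (ω : ι → ℝ) (x : E) :
    σ.interp ω x = ∑ u, σ.coord x u * ω u := by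
  simp [interp, coord, Module.Basis.constr_apply_fintype]

theorem interp_apply_self (σ : BasisSet w) (ω : ι → ℝ) (u : ι) (hu : u ∈ σ.1) :
    σ.interp ω (w u) = ω u := by
  have := σ.basis.constr_basis ℝ (fun u : σ.1 => ω u) ⟨u, hu⟩
  simpa [interp] using this

end BasisSet

variable [Fintype ι]

/-- Points off the walls of all simplicial cones spanned by subfamilies of `w`. -/
def AvoidsWalls (w : ι → E) (x : E) : Prop := ∀ σ : BasisSet w, ∀ u, σ.coord x u ≠ 0

/-- The weight `ω` is off the walls of the secondary fan. -/
def IsGenericWeight (w : ι → E) (ω : ι → ℝ) : Prop :=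
  ∀ σ : BasisSet w, ∀ v ∉ σ.1, σ.interp ω (w v) ≠ ω v

/-- The maximal cells of the regular subdivision given by `ω`. -/
def regularCells (w : ι → E) (ω : ι → ℝ) : Set (BasisSet w) :=
  {σ | ∀ v ∉ σ.1, σ.interp ω (w v) < ω v}

/-- Each condition excludes the zeros of a linear form in ω whose coefficient at ω v is -1, as v ∉
σ. -/
theorem exists_isGenericWeight (w : ι → E) : ∃ ω : ι → ℝ, (∀ i, 0 < ω i) ∧ IsGenericWeight w ω := by
  classical
  obtain ⟨ω, h0, hω⟩ := exists_pos_dotProduct_ne_zero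
    (fun (j : {j : BasisSet w × ι // j.2 ∉ j.1.1}) (i : ι) =>
      (if h : i ∈ j.1.1.1 then j.1.1.coord (w j.1.2) ⟨i, h⟩ else 0) -
        if i = j.1.2 then 1 else 0) (by
    intro j h
    have := congrFun h j.1.2
    simp [j.2] at this)
  refine ⟨ω, h0, fun σ v hv h => hω ⟨(σ, v), hv⟩ ?_⟩
  simp only [sub_mul, Finset.sum_sub_distrib, ite_mul, one_mul, zero_mul, Finset.sum_ite_eq',
    Finset.mem_univ, if_true]
  rw [sub_eq_zero, ← h, σ.interp_apply]
  rw [σ.sum_eq_sum_coe fun i hi => by rw [dif_neg hi, zero_mul]]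
  exact Finset.sum_congr rfl fun u _ => by simp

theorem exists_avoidsWalls (w : ι → E) :
    ∃ t : ι → ℝ, (∀ i, 0 < t i) ∧ AvoidsWalls w (∑ i, t i • w i) := by
  classical
  obtain ⟨t, h0, ht⟩ := exists_pos_dotProduct_ne_zero
    (fun (j : Σ σ : BasisSet w, σ.1) (i : ι) => j.1.coord (w i) j.2) (by
    intro j h
    have := congrFun h j.2
    simp [BasisSet.coord_apply_self] at this)
  refine ⟨t, h0, fun σ u h => ht ⟨σ, u⟩ ?_⟩
  rw [← h, map_sum, Finset.sum_apply]
  exact Finset.sum_congr rfl fun i _ => by simp [mul_comm]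

/-- The functional of σ is at most ω on every generator, so at x it is at most the functional of τ,
strictly if τ has a generator outside σ. By symmetry the two values agree and σ = τ. -/
theorem regularCells_eq_of_pos {ω : ι → ℝ} {σ τ : BasisSet w} (hσ : σ ∈ regularCells w ω)
    (hτ : τ ∈ regularCells w ω) {x : E} (hxσ : ∀ u, 0 < σ.coord x u)
    (hxτ : ∀ u, 0 < τ.coord x u) : σ = τ := by
  have key : ∀ σ τ : BasisSet w, σ ∈ regularCells w ω → (∀ u, 0 < τ.coord x u) →
      σ.interp ω x ≤ τ.interp ω x ∧ (¬ τ.1 ⊆ σ.1 → σ.interp ω x < τ.interp ω x) := by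
    intro σ τ hσ hxτ
    have hle : ∀ v, σ.interp ω (w v) ≤ ω v := fun v => by
      by_cases hv : v ∈ σ.1
      · exact (σ.interp_apply_self ω v hv).le
      · exact (hσ v hv).le
    have hx : σ.interp ω x = ∑ v, τ.coord x v * σ.interp ω (w v) := by
      conv_lhs => rw [← τ.sum_coord_smul x, map_sum]
      exact Finset.sum_congr rfl fun v _ => by simp
    rw [hx, τ.interp_apply]
    refine ⟨Finset.sum_le_sum fun v _ => mul_le_mul_of_nonneg_left (hle v) (hxτ v).le,
      fun hsub => ?_⟩
    obtain ⟨v, hvτ, hvσ⟩ := Set.not_subset.1 hsub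
    exact Finset.sum_lt_sum (fun v _ => mul_le_mul_of_nonneg_left (hle v) (hxτ v).le)
      ⟨⟨v, hvτ⟩, Finset.mem_univ _, mul_lt_mul_of_pos_left (hσ v hvσ) (hxτ _)⟩
  have h1 := key σ τ hσ hxτ
  have h2 := key τ σ hτ hxσ
  apply Subtype.ext
  apply Set.Subset.antisymm
  · by_contra h
    exact absurd (h2.2 h) (not_lt.2 h1.1)
  · by_contra h
    exact absurd (h1.2 h) (not_lt.2 h2.1)

/-- A linear program with positive costs has an optimal solution with linearly independent
support. -/
theorem exists_optimal_linearIndepOn_support {ω : ι → ℝ} (hω : ∀ i, 0 < ω i) {x : E}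
    (hx : ∃ a : ι → ℝ, 0 ≤ a ∧ ∑ i, a i • w i = x) :
    ∃ a : ι → ℝ, (0 ≤ a ∧ ∑ i, a i • w i = x) ∧
      (∀ b : ι → ℝ, 0 ≤ b → ∑ i, b i • w i = x → ∑ i, ω i * a i ≤ ∑ i, ω i * b i) ∧
      LinearIndepOn ℝ w (Function.support a) := by
  classical
  obtain ⟨a₀, ha₀, hx₀⟩ := hx
  set F : Set (ι → ℝ) := {a | 0 ≤ a ∧ ∑ i, a i • w i = x} with hF
  set O : Set (ι → ℝ) := {a | a ∈ F ∧ ∀ b ∈ F, ∑ i, ω i * a i ≤ ∑ i, ω i * b i} with hO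
  have hO_ne : O.Nonempty := by
    set M := ∑ i, ω i * a₀ i with hM
    -- Positive costs bound every coordinate by M / ω i, so a minimum exists.
    have hcomp : IsCompact (F ∩ {a | ∑ i, ω i * a i ≤ M}) := by
      refine IsCompact.of_isClosed_subset
        (isCompact_univ_pi fun i => isCompact_Icc (a := (0 : ℝ)) (b := M / ω i)) ?_ ?_
      · refine IsClosed.inter (IsClosed.inter (isClosed_le continuous_const continuous_id) ?_) ?_
        · exact isClosed_eq (by fun_prop) continuous_const
        · exact isClosed_le (by fun_prop) continuous_const
      · rintro a ⟨⟨ha, _⟩, haM⟩ i _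
        refine ⟨ha i, ?_⟩
        rw [le_div_iff₀ (hω i), mul_comm]
        exact (Finset.single_le_sum (f := fun i => ω i * a i)
          (fun i _ => mul_nonneg (hω i).le (ha i)) (Finset.mem_univ i)).trans haM
    obtain ⟨a, ha, hmin⟩ := hcomp.exists_isMinOn (f := fun a : ι → ℝ => ∑ i, ω i * a i)
      ⟨a₀, ⟨ha₀, hx₀⟩, le_refl M⟩ (by fun_prop)
    refine ⟨a, ha.1, fun b hb => ?_⟩
    by_cases hbM : ∑ i, ω i * b i ≤ M
    · exact hmin ⟨hb, hbM⟩
    · exact ha.2.trans (not_le.1 hbM).le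
  -- Take an optimal solution of smallest support. A linear relation μ on the support, with sign
  -- chosen so that its cost is non-negative, would give an optimal a - t • μ of smaller support.
  obtain ⟨a, haO, hmin⟩ : ∃ a ∈ O, ∀ b ∈ O, (Finset.univ.filter fun i => a i ≠ 0).card ≤
      (Finset.univ.filter fun i => b i ≠ 0).card := by
    refine ⟨Function.argminOn (fun a : ι → ℝ => (Finset.univ.filter fun i => a i ≠ 0).card)
      O hO_ne, Function.argminOn_mem _ _ _, fun b hb => ?_⟩
    exact Function.argminOn_le (fun a : ι → ℝ => (Finset.univ.filter fun i => a i ≠ 0).card) O hb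
  refine ⟨a, haO.1, fun b hb hbx => haO.2 b ⟨hb, hbx⟩, ?_⟩
  by_contra hdep
  have hsupp : Function.support a = ((Finset.univ.filter fun i => a i ≠ 0 : Finset ι) : Set ι) := by
    ext i
    simp
  rw [hsupp, not_linearIndepOn_finset_iff] at hdep
  obtain ⟨f, hf0, k, hk, hfk⟩ := hdep
  obtain ⟨μ, hμ0, hμs, hμω, hμpos⟩ : ∃ μ : ι → ℝ, ∑ i, μ i • w i = 0 ∧
      (∀ i, a i = 0 → μ i = 0) ∧ 0 ≤ ∑ i, ω i * μ i ∧ ∃ i, 0 < μ i := by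
    set ν : ι → ℝ := fun i => if a i ≠ 0 then f i else 0 with hν
    have hν0 : ∑ i, ν i • w i = 0 := by
      rw [← hf0, Finset.sum_filter]
      exact Finset.sum_congr rfl fun i _ => by simp only [hν]; split_ifs <;> simp
    have hνs : ∀ i, a i = 0 → ν i = 0 := fun i hi => by simp [hν, hi]
    have hνk : ν k ≠ 0 := by
      have : a k ≠ 0 := by simpa using hk
      simpa [hν, this] using hfk
    have aux : ∀ ν : ι → ℝ, ν k ≠ 0 → 0 ≤ ∑ i, ω i * ν i → ∃ i, 0 < ν i := by
      intro ν hνk h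
      by_contra! hneg
      have : ∑ i, ω i * ν i < 0 :=
        Finset.sum_neg' (fun i _ => mul_nonpos_of_nonneg_of_nonpos (hω i).le (hneg i))
          ⟨k, Finset.mem_univ k, mul_neg_of_pos_of_neg (hω k) (lt_of_le_of_ne (hneg k) hνk)⟩
      linarith
    by_cases hs : 0 ≤ ∑ i, ω i * ν i
    · exact ⟨ν, hν0, hνs, hs, aux ν hνk hs⟩
    · have hs' : 0 ≤ ∑ i, ω i * (-ν) i := by
        simp only [Pi.neg_apply, mul_neg, Finset.sum_neg_distrib]
        linarith
      refine ⟨-ν, ?_, fun i hi => by simp [hνs i hi], hs', aux (-ν) (by simpa using hνk) hs'⟩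
      simp [hν0]
  obtain ⟨t, ht0, hnn, j, hj, hjz⟩ := exists_sub_smul_nonneg haO.1.1 hμpos
  have hbO : a - t • μ ∈ O := by
    refine ⟨⟨hnn, ?_⟩, fun b hb => ?_⟩
    · simp only [Pi.sub_apply, Pi.smul_apply, smul_eq_mul, sub_smul, mul_smul,
        Finset.sum_sub_distrib, ← Finset.smul_sum, hμ0, smul_zero, sub_zero]
      exact haO.1.2
    · refine le_trans ?_ (haO.2 b hb)
      simp only [Pi.sub_apply, Pi.smul_apply, smul_eq_mul, mul_sub, Finset.sum_sub_distrib]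
      have : ∑ i, ω i * (t * μ i) = t * ∑ i, ω i * μ i := by
        rw [Finset.mul_sum]
        exact Finset.sum_congr rfl fun i _ => by ring
      rw [this]
      linarith [mul_nonneg ht0 hμω]
  refine absurd (hmin _ hbO) (not_le.2 (Finset.card_lt_card ?_))
  rw [Finset.ssubset_iff_of_subset]
  · refine ⟨j, ?_, by simpa using hjz⟩
    simp only [Finset.mem_filter, Finset.mem_univ, true_and]
    exact fun h => hj.ne' (hμs j h)
  · intro i
    simp only [Finset.mem_filter, Finset.mem_univ, true_and]
    intro hi h
    exact hi (by simp [h, hμs i h])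

/-- Linear programming: an optimal solution with independent support extends to a basis σ, in which
x has positive coordinates since it avoids the walls. Optimality makes the reduced costs ω v -
σ.interp ω (w v) non-negative, and genericity makes them positive. -/
theorem exists_mem_regularCells {ω : ι → ℝ} (hw : Submodule.span ℝ (Set.range w) = ⊤)
    (hω : ∀ i, 0 < ω i) (hgen : IsGenericWeight w ω) {x : E} (hxg : AvoidsWalls w x)
    (hx : ∃ a : ι → ℝ, 0 ≤ a ∧ ∑ i, a i • w i = x) :
    ∃ σ ∈ regularCells w ω, ∀ u, 0 < σ.coord x u := by
  classical
  obtain ⟨a, ⟨ha, hax⟩, hopt, hli⟩ := exists_optimal_linearIndepOn_support hω hx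
  obtain ⟨s, _, hs, hspan, hsli⟩ := exists_linearIndepOn_extension hli (Set.subset_univ _)
  have htop : ⊤ ≤ Submodule.span ℝ (w '' s) := by
    rw [← hw, Submodule.span_le, ← Set.image_univ]
    exact hspan
  let σ : BasisSet w := ⟨s, hsli, htop⟩
  have ha0 : ∀ i ∉ σ.1, a i = 0 := fun i hi => by
    by_contra h
    exact hi (hs h)
  have hcoord : ∀ u : σ.1, σ.coord x u = a u := by
    intro u
    rw [← hax, σ.sum_eq_sum_coe fun i hi => by rw [ha0 i hi, zero_smul], σ.coord_sum]
  have hpos : ∀ u : σ.1, 0 < a u := fun u =>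
    lt_of_le_of_ne (ha u) (hcoord u ▸ (hxg σ u).symm)
  refine ⟨σ, fun v hv => lt_of_le_of_ne ?_ (hgen σ v hv), fun u => hcoord u ▸ hpos u⟩
  set μ : ι → ℝ := fun i => if h : i ∈ σ.1 then σ.coord (w v) ⟨i, h⟩ else 0 with hμ
  have hμ0 : ∀ i ∉ σ.1, μ i = 0 := fun i hi => by simp [hμ, hi]
  have hμc : ∀ u : σ.1, μ u = σ.coord (w v) u := fun u => by simp [hμ]
  have hμw : ∑ i, μ i • w i = w v := by
    rw [σ.sum_eq_sum_coe fun i hi => by rw [hμ0 i hi, zero_smul]]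
    simp only [hμc]
    exact σ.sum_coord_smul (w v)
  obtain ⟨t, ht0, ht⟩ : ∃ t : ℝ, 0 < t ∧ ∀ u : σ.1, 0 < a u - t * μ u := by
    have h1 : ∀ᶠ t in nhdsWithin (0 : ℝ) (Set.Ioi 0), ∀ u : σ.1, 0 < a u - t * μ u := by
      rw [Filter.eventually_all]
      intro u
      refine Filter.Tendsto.eventually_const_lt (hpos u) ?_
      refine tendsto_nhdsWithin_of_tendsto_nhds ?_
      have : Continuous fun t : ℝ => a u - t * μ u := by fun_prop
      simpa using this.tendsto 0
    obtain ⟨t, h2, h3⟩ := (h1.and self_mem_nhdsWithin).exists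
    exact ⟨t, h3, h2⟩
  -- Pivot: put weight t on w v and subtract t times its expansion in σ. The point x is unchanged
  -- and the cost changes by t times the reduced cost.
  set b : ι → ℝ := a - t • μ + t • Pi.single v 1 with hb
  have hsum : ∑ i, (Pi.single v (1 : ℝ) : ι → ℝ) i • w i = w v := by
    simp [Pi.single_apply, ite_smul]
  have hb0 : 0 ≤ b := by
    intro i
    by_cases hi : i ∈ σ.1
    · have hiv : i ≠ v := fun h => hv (h ▸ hi)
      have := ht ⟨i, hi⟩
      simp only [hb, Pi.zero_apply, Pi.add_apply, Pi.sub_apply, Pi.smul_apply, smul_eq_mul,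
        Pi.single_apply, if_neg hiv, mul_zero, add_zero]
      exact this.le
    · simp only [hb, Pi.zero_apply, Pi.add_apply, Pi.sub_apply, Pi.smul_apply, smul_eq_mul,
        hμ0 i hi, ha0 i hi, Pi.single_apply]
      split_ifs <;> simp [ht0.le]
  have hbx : ∑ i, b i • w i = x := by
    simp only [hb, Pi.add_apply, Pi.sub_apply, Pi.smul_apply, add_smul, sub_smul,
      Finset.sum_add_distrib, Finset.sum_sub_distrib, smul_assoc, ← Finset.smul_sum, hμw, hsum, hax]
    abel
  have h1 := hopt b hb0 hbx
  have h2 : ∑ i, ω i * b i = ∑ i, ω i * a i - t * ∑ i, μ i * ω i + t * ω v := by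
    have e1 : ∑ i, ω i * (t * (Pi.single v (1 : ℝ) : ι → ℝ) i) = t * ω v := by
      simp [Pi.single_apply, mul_comm]
    simp only [hb, Pi.add_apply, Pi.sub_apply, Pi.smul_apply, smul_eq_mul, mul_add, mul_sub,
      Finset.sum_add_distrib, Finset.sum_sub_distrib, e1]
    rw [Finset.mul_sum]
    congr 2
    exact Finset.sum_congr rfl fun i _ => by ring
  have h3 : ∑ i, μ i * ω i = σ.interp ω (w v) := by
    rw [σ.interp_apply, σ.sum_eq_sum_coe fun i hi => by rw [hμ0 i hi, zero_mul]]
    exact Finset.sum_congr rfl fun u _ => by rw [hμc]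
  rw [h2, h3] at h1
  by_contra hlt
  push Not at hlt
  nlinarith

/-- The half-open cone of a basis. -/
def BasisSet.cone (σ : BasisSet w) (S : Set σ.1) : Set E := halfOpenCone σ.coord.toAddMonoidHom S

theorem eventually_add_smul_pos (a : ℝ) {b : ℝ} (hb : b ≠ 0) :
    ∀ᶠ ε in nhdsWithin (0 : ℝ) (Set.Ioi 0), a + ε * b ≠ 0 ∧
      (0 < a + ε * b ↔ (b < 0 → 0 < a) ∧ (¬ b < 0 → 0 ≤ a)) := by
  have hten : Filter.Tendsto (fun ε : ℝ => a + ε * b) (nhdsWithin 0 (Set.Ioi 0)) (nhds a) := by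
    refine tendsto_nhdsWithin_of_tendsto_nhds ?_
    have : Continuous fun ε : ℝ => a + ε * b := by fun_prop
    simpa using this.tendsto 0
  rcases lt_trichotomy a 0 with ha | rfl | ha
  · filter_upwards [hten.eventually_lt_const ha] with ε hε
    refine ⟨hε.ne, iff_of_false (not_lt.2 hε.le) fun h => ?_⟩
    by_cases hb' : b < 0
    · linarith [h.1 hb']
    · linarith [h.2 hb']
  · filter_upwards [self_mem_nhdsWithin] with ε (hε : 0 < ε)
    rw [zero_add]
    refine ⟨mul_ne_zero hε.ne' hb, ?_⟩
    rw [mul_pos_iff_of_pos_left hε]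
    constructor
    · exact fun h => ⟨fun h' => absurd h' (not_lt.2 h.le), fun _ => le_refl _⟩
    · exact fun h => lt_of_le_of_ne (not_lt.1 fun hb' => lt_irrefl _ (h.1 hb')) hb.symm
  · filter_upwards [hten.eventually_const_lt ha] with ε hε
    exact ⟨hε.ne', iff_of_true hε ⟨fun _ => ha, fun _ => ha.le⟩⟩

/-- For small ε > 0 a coordinate of x + ε • q has the sign of that of x, or of that of q where the
former vanishes. So the half-open cone consists of the x that a small push along q moves into the
open cone. -/
theorem eventually_avoidsWalls_add_smul {q : E} (hq : AvoidsWalls w q) (x : E) :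
    ∀ᶠ ε in nhdsWithin (0 : ℝ) (Set.Ioi 0), AvoidsWalls w (x + ε • q) ∧
      ∀ σ : BasisSet w, (∀ u, 0 < σ.coord (x + ε • q) u) ↔ x ∈ σ.cone {u | σ.coord q u < 0} := by
  have h : ∀ᶠ ε in nhdsWithin (0 : ℝ) (Set.Ioi 0), ∀ σ : BasisSet w, ∀ u : σ.1,
      σ.coord x u + ε * σ.coord q u ≠ 0 ∧ (0 < σ.coord x u + ε * σ.coord q u ↔
        (σ.coord q u < 0 → 0 < σ.coord x u) ∧ (¬ σ.coord q u < 0 → 0 ≤ σ.coord x u)) := by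
    rw [Filter.eventually_all]
    intro σ
    rw [Filter.eventually_all]
    exact fun u => eventually_add_smul_pos _ (hq σ u)
  filter_upwards [h] with ε hε
  have hc : ∀ σ : BasisSet w, ∀ u, σ.coord (x + ε • q) u = σ.coord x u + ε * σ.coord q u := by
    intro σ u
    simp
  refine ⟨fun σ u => ?_, fun σ => ?_⟩
  · rw [hc]
    exact (hε σ u).1
  · simp only [hc, (hε σ _).2]
    rfl

/-- Half-open decomposition of a polyhedral cone, with the complementary decomposition of its
relative interior. -/
theorem exists_halfOpen_decomposition (hw : Submodule.span ℝ (Set.range w) = ⊤) :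
    ∃ (T : Set (BasisSet w)) (S : ∀ σ : BasisSet w, Set σ.1),
      (∀ x, (∃ a : ι → ℝ, 0 ≤ a ∧ ∑ i, a i • w i = x) ↔ ∃ σ ∈ T, x ∈ σ.cone (S σ)) ∧
      (∀ x, (∃ a : ι → ℝ, (∀ i, 0 < a i) ∧ ∑ i, a i • w i = x) ↔
        ∃ σ ∈ T, x ∈ σ.cone (S σ)ᶜ) ∧
      T.PairwiseDisjoint (fun σ => σ.cone (S σ)) ∧
      T.PairwiseDisjoint (fun σ => σ.cone (S σ)ᶜ) := by
  classical
  obtain ⟨ω, hω, hgen⟩ := exists_isGenericWeight w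
  obtain ⟨t, ht, hq⟩ := exists_avoidsWalls w
  -- Pushing along q keeps the points of the closed cone in the cone; pushing along -q does so for
  -- the interior points only. Passing from q to -q complements each S.
  set q := ∑ i, t i • w i with hqt
  have hq' : AvoidsWalls w (-q) := fun σ u => by simpa using hq σ u
  have hS' : ∀ σ : BasisSet w, {u | σ.coord (-q) u < 0} = {u | σ.coord q u < 0}ᶜ := by
    intro σ
    ext u
    simp only [map_neg, Pi.neg_apply, Set.mem_ofPred_eq, Set.mem_compl_iff, not_lt, neg_neg_iff_pos]
    exact ⟨le_of_lt, fun h => lt_of_le_of_ne h (hq σ u).symm⟩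
  have hdisj : ∀ q : E, AvoidsWalls w q →
      (regularCells w ω).PairwiseDisjoint fun σ => σ.cone {u | σ.coord q u < 0} := by
    intro q hq σ hσ τ hτ hne
    rw [Function.onFun, Set.disjoint_left]
    intro x hxσ hxτ
    obtain ⟨ε, -, hε⟩ := (eventually_avoidsWalls_add_smul hq x).exists
    exact hne (regularCells_eq_of_pos hσ hτ ((hε σ).2 hxσ) ((hε τ).2 hxτ))
  have hcone : ∀ (σ : BasisSet w) (x : E), (∀ u, 0 ≤ σ.coord x u) →
      ∃ a : ι → ℝ, 0 ≤ a ∧ ∑ i, a i • w i = x := by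
    intro σ x hx
    refine ⟨fun i => if h : i ∈ σ.1 then σ.coord x ⟨i, h⟩ else 0, fun i => ?_, ?_⟩
    · simp only [Pi.zero_apply]
      split_ifs with h
      · exact hx _
      · exact le_rfl
    · rw [σ.sum_eq_sum_coe (fun i hi => by simp [hi])]
      simp only [Subtype.coe_prop, dif_pos, Subtype.coe_eta]
      exact σ.sum_coord_smul x
  have hcone' : ∀ (σ : BasisSet w) (S : Set σ.1) (x : E), x ∈ σ.cone S → ∀ u, 0 ≤ σ.coord x u := by
    intro σ S x hx u
    by_cases hu : u ∈ S
    · exact ((hx u).1 hu).le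
    · exact (hx u).2 hu
  refine ⟨regularCells w ω, fun σ => {u | σ.coord q u < 0}, fun x => ⟨?_, ?_⟩, fun x => ⟨?_, ?_⟩,
    hdisj q hq, ?_⟩
  · rintro ⟨a, ha, hax⟩
    obtain ⟨ε, ⟨hg, hε⟩, hε0⟩ :=
      ((eventually_avoidsWalls_add_smul hq x).and self_mem_nhdsWithin).exists
    obtain ⟨σ, hσ, hpos⟩ := exists_mem_regularCells hw hω hgen hg ⟨a + ε • t, fun i => by
        have h1 := ha i
        have h2 := mul_pos hε0 (ht i)
        simp only [Pi.zero_apply, Pi.add_apply, Pi.smul_apply, smul_eq_mul] at h1 ⊢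
        linarith, by
        simp [add_smul, Finset.sum_add_distrib, mul_smul, ← Finset.smul_sum, hax, hqt]⟩
    exact ⟨σ, hσ, (hε σ).1 hpos⟩
  · rintro ⟨σ, -, hx⟩
    exact hcone σ x (hcone' σ _ x hx)
  · rintro ⟨a, ha, hax⟩
    have hsmall : ∀ᶠ ε in nhdsWithin (0 : ℝ) (Set.Ioi 0), ∀ i, 0 < a i - ε * t i := by
      rw [Filter.eventually_all]
      intro i
      refine Filter.Tendsto.eventually_const_lt (ha i) ?_
      refine tendsto_nhdsWithin_of_tendsto_nhds ?_
      have : Continuous fun ε : ℝ => a i - ε * t i := by fun_prop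
      simpa using this.tendsto 0
    obtain ⟨ε, ⟨hg, hε⟩, hεa⟩ :=
      ((eventually_avoidsWalls_add_smul hq' x).and hsmall).exists
    obtain ⟨σ, hσ, hpos⟩ := exists_mem_regularCells hw hω hgen hg ⟨a - ε • t, fun i => by
        simpa using (hεa i).le, by
        simp only [Pi.sub_apply, Pi.smul_apply, smul_eq_mul, sub_smul, Finset.sum_sub_distrib,
          mul_smul, ← Finset.smul_sum, hax, hqt, smul_neg, ← sub_eq_add_neg]⟩
    have := (hε σ).1 hpos
    rw [hS'] at this
    exact ⟨σ, hσ, this⟩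
  · rintro ⟨σ, -, hx⟩
    rw [← hS'] at hx
    obtain ⟨ε, ⟨hg, hε⟩, hε0⟩ :=
      ((eventually_avoidsWalls_add_smul hq' x).and self_mem_nhdsWithin).exists
    obtain ⟨a, ha, hax⟩ := hcone σ _ fun u => ((hε σ).2 hx u).le
    refine ⟨a + ε • t, fun i => ?_, ?_⟩
    · have h1 := ha i
      have h2 := mul_pos hε0 (ht i)
      simp only [Pi.zero_apply, Pi.add_apply, Pi.smul_apply, smul_eq_mul] at h1 ⊢
      linarith
    · simp [add_smul, Finset.sum_add_distrib, mul_smul, ← Finset.smul_sum, hax, ← hqt]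
  · simpa only [hS'] using hdisj (-q) hq'

end Triangulation

/-! ### The cone over lattice points and its lattice -/

theorem eval_neg_of_isHomogeneous {σ R : Type*} [CommRing R] {φ : MvPolynomial σ R} {d : ℕ}
    (hφ : φ.IsHomogeneous d) (x : σ → R) :
    MvPolynomial.eval (fun i => -x i) φ = (-1) ^ d * MvPolynomial.eval x φ := by
  rw [MvPolynomial.eval_eq, MvPolynomial.eval_eq, Finset.mul_sum]
  refine Finset.sum_congr rfl fun m hm => ?_
  have hm' : ∑ i ∈ m.support, m i = d := by
    have := hφ (MvPolynomial.mem_support_iff.1 hm)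
    simpa [Finsupp.weight_apply, Finsupp.sum] using this
  have : ∏ i ∈ m.support, (-x i) ^ m i = (-1) ^ d * ∏ i ∈ m.support, x i ^ m i := by
    rw [← hm', ← Finset.prod_pow_eq_pow_sum, ← Finset.prod_mul_distrib]
    exact Finset.prod_congr rfl fun i _ => neg_pow _ _
  rw [this]
  ring

section LatticeCone

variable {n : ℕ} {ι : Type*}

/-- The generators `(p i, 1)` of the cone over the points `p i`. -/
def homogenize (p : ι → Fin n → ℝ) (i : ι) : (Fin n → ℝ) × ℝ := (p i, 1)

/-- The shear (x, t) ↦ (x - t • p i₀, t) maps the span onto `V.prod ⊤`. Hence every cell of the cone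
has dim + 1 generators. -/
theorem finrank_span_homogenize [Nonempty ι] (p : ι → Fin n → ℝ) :
    Module.finrank ℝ (Submodule.span ℝ (Set.range (homogenize p))) =
      Module.finrank ℝ (vectorSpan ℝ (Set.range p)) + 1 := by
  obtain ⟨i₀⟩ := ‹Nonempty ι›
  set V := vectorSpan ℝ (Set.range p) with hV
  let A : ((Fin n → ℝ) × ℝ) ≃ₗ[ℝ] ((Fin n → ℝ) × ℝ) :=
    { toFun := fun x => (x.1 - x.2 • p i₀, x.2)
      invFun := fun x => (x.1 + x.2 • p i₀, x.2)
      map_add' := fun x y => by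
        ext1
        · simp only [Prod.fst_add, Prod.snd_add, add_smul]
          abel
        · rfl
      map_smul' := fun c x => by
        ext1
        · simp [smul_sub, mul_smul]
        · rfl
      left_inv := fun x => by simp
      right_inv := fun x => by simp }
  have hA : ∀ i, A (homogenize p i) = (p i - p i₀, 1) := fun i => by simp [A, homogenize]
  have hmap : (Submodule.span ℝ (Set.range (homogenize p))).map A.toLinearMap =
      V.prod ⊤ := by
    apply le_antisymm
    · rw [Submodule.map_span_le]
      rintro _ ⟨i, rfl⟩
      rw [LinearEquiv.coe_coe, hA, Submodule.mem_prod]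
      exact ⟨vsub_mem_vectorSpan ℝ ⟨i, rfl⟩ ⟨i₀, rfl⟩, Submodule.mem_top⟩
    · have hgen : ∀ i, ((p i - p i₀, 1) : (Fin n → ℝ) × ℝ) ∈
          (Submodule.span ℝ (Set.range (homogenize p))).map A.toLinearMap := fun i =>
        ⟨_, Submodule.subset_span ⟨i, rfl⟩, hA i⟩
      have hinl : V ≤ ((Submodule.span ℝ (Set.range (homogenize p))).map A.toLinearMap).comap
          (LinearMap.inl ℝ (Fin n → ℝ) ℝ) := by
        rw [hV, vectorSpan_range_eq_span_range_vsub_right ℝ p i₀, Submodule.span_le]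
        rintro _ ⟨i, rfl⟩
        have := sub_mem (hgen i) (hgen i₀)
        rw [Prod.mk_sub_mk, sub_self, sub_self, sub_zero] at this
        exact this
      rintro ⟨x, t⟩ ⟨hx, -⟩
      have h1 := hinl hx
      have h2 := Submodule.smul_mem _ t (hgen i₀)
      have := add_mem (Submodule.mem_comap.1 h1) h2
      rw [LinearMap.inl_apply, Prod.smul_mk, sub_self, smul_zero, Prod.mk_add_mk, add_zero,
        zero_add, smul_eq_mul, mul_one] at this
      exact this
  rw [← LinearEquiv.finrank_map_eq A, hmap]
  have hrange : V.prod (⊤ : Submodule ℝ ℝ) =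
      LinearMap.range (V.subtype.prodMap (LinearMap.id : ℝ →ₗ[ℝ] ℝ)) := by
    rw [LinearMap.range_prodMap, Submodule.range_subtype, LinearMap.range_id]
  rw [hrange, LinearMap.finrank_range_of_inj, Module.finrank_prod, Module.finrank_self]
  exact V.injective_subtype.prodMap Function.injective_id

/-- The span of the generators. -/
abbrev coneSpan (p : ι → Fin n → ℝ) : Submodule ℝ ((Fin n → ℝ) × ℝ) :=
  Submodule.span ℝ (Set.range (homogenize p))

/-- The generators, as elements of their span. -/
def coneGen (p : ι → Fin n → ℝ) (i : ι) : coneSpan p :=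
  ⟨homogenize p i, Submodule.subset_span ⟨i, rfl⟩⟩

theorem span_range_coneGen (p : ι → Fin n → ℝ) :
    Submodule.span ℝ (Set.range (coneGen p)) = ⊤ := by
  apply Submodule.map_injective_of_injective (coneSpan p).injective_subtype
  rw [Submodule.map_span, Submodule.map_top, Submodule.range_subtype, ← Set.range_comp]
  rfl

/-- The inclusion of `ℤⁿ × ℤ` in `ℝⁿ × ℝ`. -/
def latticeProdHom (n : ℕ) : (Fin n → ℤ) × ℤ →+ (Fin n → ℝ) × ℝ where
  toFun x := (latticeVec x.1, (x.2 : ℝ))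
  map_zero' := by
    ext <;> simp [latticeVec]
  map_add' x y := by
    ext <;> simp [latticeVec]

/-- The lattice points of the span of the cone over lattice points. -/
abbrev coneLattice (p : ι → Fin n → ℤ) : AddSubgroup ((Fin n → ℤ) × ℤ) :=
  (coneSpan fun i => latticeVec (p i)).toAddSubgroup.comap (latticeProdHom n)

/-- The inclusion of the lattice in the span. -/
def coneLatticeHom (p : ι → Fin n → ℤ) :
    coneLattice p →+ coneSpan fun i => latticeVec (p i) where
  toFun x := ⟨latticeProdHom n x.1, x.2⟩
  map_zero' := Subtype.ext (by simp)
  map_add' x y := Subtype.ext (by simp)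

/-- The generators, as lattice points. -/
def coneLatticeGen (p : ι → Fin n → ℤ) (i : ι) : coneLattice p :=
  ⟨(p i, 1), by
    have : latticeProdHom n (p i, 1) = homogenize (fun i => latticeVec (p i)) i := by
      simp [latticeProdHom, homogenize]
    rw [AddSubgroup.mem_comap, this]
    exact Submodule.subset_span ⟨i, rfl⟩⟩

theorem coneLatticeHom_gen (p : ι → Fin n → ℤ) (i : ι) :
    coneLatticeHom p (coneLatticeGen p i) = coneGen (fun i => latticeVec (p i)) i :=
  Subtype.ext (by simp [coneLatticeHom, coneLatticeGen, coneGen, latticeProdHom, homogenize])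

/-- The last coordinate. -/
def coneHeight (p : ι → Fin n → ℤ) : coneLattice p →+ ℤ :=
  (AddMonoidHom.snd (Fin n → ℤ) ℤ).comp (coneLattice p).subtype

variable [Fintype ι]

theorem coneGen_sum_fst (p : ι → Fin n → ℝ) (a : ι → ℝ) :
    ((∑ i, a i • coneGen p i : coneSpan p) : (Fin n → ℝ) × ℝ) = (∑ i, a i • p i, ∑ i, a i) := by
  rw [Submodule.coe_sum]
  ext1
  · simp [coneGen, homogenize, Prod.fst_sum]
  · simp [coneGen, homogenize, Prod.snd_sum]

theorem coneHeight_eq_sum_coord (p : ι → Fin n → ℤ)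
    (σ : BasisSet (coneGen fun i => latticeVec (p i))) (x : coneLattice p) :
    (coneHeight p x : ℝ) = ∑ u, σ.coord (coneLatticeHom p x) u := by
  have h := congrArg (fun y : coneSpan fun i => latticeVec (p i) => (y : (Fin n → ℝ) × ℝ).2)
      (σ.sum_coord_smul (coneLatticeHom p x))
  simp only [Submodule.coe_sum, Prod.snd_sum] at h
  refine Eq.trans (show _ = (coneLatticeHom p x : (Fin n → ℝ) × ℝ).2 from rfl) ?_
  rw [← h]
  simp [coneGen, homogenize]

theorem finite_coneLattice_bounded (p : ι → Fin n → ℤ)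
    (σ : BasisSet (coneGen fun i => latticeVec (p i))) (R : ℝ) :
    {x : coneLattice p | ∀ u, |σ.coord (coneLatticeHom p x) u| ≤ R}.Finite := by
  classical
  set M : ℝ := ∑ u : σ.1, R * ‖coneGen (fun i => latticeVec (p i)) u‖ with hM
  refine Set.Finite.of_finite_image (f := Subtype.val) ?_ Subtype.val_injective.injOn
  refine ((Set.finite_Icc (fun _ => -⌈M⌉ : Fin n → ℤ) (fun _ => ⌈M⌉)).prod
    (Set.finite_Icc (-⌈M⌉) ⌈M⌉)).subset ?_
  rintro _ ⟨x, hx, rfl⟩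
  have hn : ‖coneLatticeHom p x‖ ≤ M := by
    rw [← σ.sum_coord_smul (coneLatticeHom p x)]
    refine norm_sum_le_of_le _ fun u _ => ?_
    rw [norm_smul]
    exact mul_le_mul_of_nonneg_right (hx u) (norm_nonneg _)
  have hn' : ‖((latticeVec x.1.1, (x.1.2 : ℝ)) : (Fin n → ℝ) × ℝ)‖ ≤ M := hn
  rw [Prod.norm_mk, max_le_iff] at hn'
  have h1 : ∀ i, |(x.1.1 i : ℝ)| ≤ (⌈M⌉ : ℤ) := fun i =>
    ((norm_le_pi_norm (latticeVec x.1.1) i).trans hn'.1).trans (Int.le_ceil M)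
  have h2 : |(x.1.2 : ℝ)| ≤ (⌈M⌉ : ℤ) := hn'.2.trans (Int.le_ceil M)
  simp only [abs_le] at h1 h2
  exact ⟨⟨fun i => by exact_mod_cast (h1 i).1, fun i => by exact_mod_cast (h1 i).2⟩,
    by exact_mod_cast h2.1, by exact_mod_cast h2.2⟩

omit [Fintype ι] in
theorem exists_mvPolynomial_evalLattice {κ : Type*} [Fintype κ] (φ : MvPolynomial (Fin n) ℂ)
    (m : Fin n → ℤ) (p : κ → Fin n → ℤ) :
    ∃ g : MvPolynomial κ ℂ, ∀ k : κ → ℤ,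
      LatticePolytope.evalLattice φ (m + ∑ u, k u • p u) =
        MvPolynomial.eval (fun u => (k u : ℂ)) g := by
  refine ⟨MvPolynomial.bind₁ (fun i => MvPolynomial.C (m i : ℂ) +
    ∑ u, MvPolynomial.C (p u i : ℂ) * MvPolynomial.X u) φ, fun k => ?_⟩
  have hC : (MvPolynomial.eval fun u => (k u : ℂ)).comp MvPolynomial.C = RingHom.id ℂ := by
    ext x
    all_goals simp
  rw [MvPolynomial.hom_bind₁, hC, LatticePolytope.evalLattice, MvPolynomial.eval]
  congr 2
  ext i
  simp [Finset.sum_apply, mul_comm]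

/-- Reciprocity for the cone over finitely many lattice points. -/
theorem exists_polynomial_cone [Nonempty ι] (p : ι → Fin n → ℤ) {φ : MvPolynomial (Fin n) ℂ}
    {d : ℕ} (hφ : φ.IsHomogeneous d) :
    ∃ C : Polynomial ℂ, ∀ l : ℤ, 0 < l →
      C.eval (l : ℂ) = ∑ᶠ m ∈ {m | ∃ a : ι → ℝ, 0 ≤ a ∧ ∑ i, a i = l ∧
        ∑ i, a i • latticeVec (p i) = latticeVec m}, LatticePolytope.evalLattice φ m ∧
      C.eval (-(l : ℂ)) =
        (-1) ^ (Module.finrank ℝ (vectorSpan ℝ (Set.range fun i => latticeVec (p i))) + d) *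
        ∑ᶠ m ∈ {m | ∃ a : ι → ℝ, (∀ i, 0 < a i) ∧ ∑ i, a i = l ∧
          ∑ i, a i • latticeVec (p i) = latticeVec m}, LatticePolytope.evalLattice φ m := by
  classical
  set w := coneGen fun i => latticeVec (p i) with hw
  obtain ⟨T, S, hT1, hT2, hd1, hd2⟩ := exists_halfOpen_decomposition
    (span_range_coneGen fun i => latticeVec (p i))
  let c : ∀ σ : BasisSet w, coneLattice p →+ (σ.1 → ℝ) := fun σ =>
    σ.coord.toAddMonoidHom.comp (coneLatticeHom p)
  -- The generators have last coordinate 1, so their span is nonzero.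
  have hne : ∀ σ : BasisSet w, Nonempty σ.1 := by
    intro σ
    by_contra hemp
    rw [not_nonempty_iff] at hemp
    obtain ⟨i⟩ := ‹Nonempty ι›
    have h := σ.sum_coord_smul (w i)
    rw [Finset.univ_eq_empty, Finset.sum_empty] at h
    have := congrArg (fun y : coneSpan fun i => latticeVec (p i) => (y : (Fin n → ℝ) × ℝ).2)
      h
    simp [hw, coneGen, homogenize] at this
  have hht : ∀ (σ : BasisSet w) x, (coneHeight p x : ℝ) = ∑ u, c σ x u :=
    coneHeight_eq_sum_coord p
  have hfin : ∀ (σ : BasisSet w) R, {x | ∀ u, |c σ x u| ≤ R}.Finite :=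
    finite_coneLattice_bounded p
  have hneg : ∀ x : coneLattice p, LatticePolytope.evalLattice φ (-x).1.1 =
      (-1) ^ d * LatticePolytope.evalLattice φ x.1.1 := by
    intro x
    rw [LatticePolytope.evalLattice, LatticePolytope.evalLattice, ← eval_neg_of_isHomogeneous hφ]
    simp
  have hcell : ∀ σ : BasisSet w, ∃ C : Polynomial ℂ, ∀ l : ℤ, 0 < l →
      C.eval (l : ℂ) = ∑ᶠ x ∈ {x | x ∈ halfOpenCone (c σ) (S σ) ∧ coneHeight p x = l},
        LatticePolytope.evalLattice φ x.1.1 ∧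
      C.eval (-(l : ℂ)) = (-1) ^ (Fintype.card σ.1 + 1 + d) *
        ∑ᶠ x ∈ {x | x ∈ halfOpenCone (c σ) (S σ)ᶜ ∧ coneHeight p x = l},
          LatticePolytope.evalLattice φ x.1.1 := by
    intro σ
    have := hne σ
    refine exists_polynomial_halfOpenCone (c := c σ) (w := fun u : σ.1 => coneLatticeGen p u)
      (fun u => ?_) (hht σ) (hfin σ) (φ := fun x => LatticePolytope.evalLattice φ x.1.1) hneg
      (fun y => ?_) (S σ)
    · exact (congrArg σ.coord (coneLatticeHom_gen p u)).trans (σ.coord_apply_self u)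
    · obtain ⟨g, hg⟩ := exists_mvPolynomial_evalLattice φ y.1.1 fun u : σ.1 => p u
      refine ⟨g, fun k => ?_⟩
      rw [← hg]
      congr 1
      simp [coneLatticeGen, Prod.fst_sum]
  choose C hC using hcell
  have hTfin : T.Finite := Set.toFinite T
  have hcard : ∀ σ : BasisSet w, Fintype.card σ.1 =
      Module.finrank ℝ (vectorSpan ℝ (Set.range fun i => latticeVec (p i))) + 1 := by
    intro σ
    rw [← finrank_span_homogenize, Module.finrank_eq_card_basis σ.basis]
  -- One computation for the closed cone and for its interior, `pos` being the sign condition on the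
  -- coefficients. Height l cuts out the l-th dilate, and fixing the height makes the projection to
  -- ℤⁿ injective.
  have hsum : ∀ (S : ∀ σ : BasisSet w, Set σ.1) (pos : (ι → ℝ) → Prop) (l : ℤ),
      (∀ x, (∃ a : ι → ℝ, pos a ∧ ∑ i, a i • w i = x) ↔ ∃ σ ∈ T, x ∈ σ.cone (S σ)) →
      T.PairwiseDisjoint (fun σ => σ.cone (S σ)) →
      ∑ᶠ m ∈ {m | ∃ a : ι → ℝ, pos a ∧ ∑ i, a i = l ∧
        ∑ i, a i • latticeVec (p i) = latticeVec m}, LatticePolytope.evalLattice φ m =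
      ∑ σ ∈ hTfin.toFinset, ∑ᶠ x ∈ {x | x ∈ halfOpenCone (c σ) (S σ) ∧ coneHeight p x = l},
        LatticePolytope.evalLattice φ x.1.1 := by
    intro S pos l hS hd
    rw [← finsum_mem_eq_finite_toFinset_sum, ← finsum_mem_biUnion ?_ hTfin fun σ _ =>
      halfOpenCone_slice_finite (hht σ) (hfin σ) (S σ) l]
    · have himg : {m | ∃ a : ι → ℝ, pos a ∧ ∑ i, a i = l ∧
          ∑ i, a i • latticeVec (p i) = latticeVec m} = (fun x : coneLattice p => x.1.1) ''
          ⋃ σ ∈ T, {x | x ∈ halfOpenCone (c σ) (S σ) ∧ coneHeight p x = l} := by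
        ext m
        simp only [Set.mem_ofPred_eq, Set.mem_image, Set.mem_iUnion, exists_prop]
        constructor
        · rintro ⟨a, ha, hal, ham⟩
          have hmem : latticeProdHom n (m, l) =
              ((∑ i, a i • w i : coneSpan fun i => latticeVec (p i)) : (Fin n → ℝ) × ℝ) := by
            rw [hw, coneGen_sum_fst, ham, hal]
            rfl
          have hx : latticeProdHom n (m, l) ∈ coneSpan fun i => latticeVec (p i) :=
            hmem ▸ Subtype.prop _
          obtain ⟨σ, hσ, hxσ⟩ := (hS ⟨_, hx⟩).1 ⟨a, ha, Subtype.ext hmem.symm⟩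
          exact ⟨⟨(m, l), hx⟩, ⟨σ, hσ, hxσ, rfl⟩, rfl⟩
        · rintro ⟨x, ⟨σ, hσ, hx, rfl⟩, rfl⟩
          obtain ⟨a, ha, hax⟩ := (hS (coneLatticeHom p x)).2 ⟨σ, hσ, hx⟩
          have h := congrArg Subtype.val hax
          rw [hw, coneGen_sum_fst] at h
          exact ⟨a, ha, congrArg Prod.snd h, congrArg Prod.fst h⟩
      rw [himg, finsum_mem_image]
      intro x hx y hy hxy
      simp only [Set.mem_iUnion, Set.mem_ofPred_eq, exists_prop] at hx hy
      obtain ⟨_, _, _, hx⟩ := hx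
      obtain ⟨_, _, _, hy⟩ := hy
      exact Subtype.ext (Prod.ext hxy (hx.trans hy.symm))
    · intro σ hσ τ hτ hne
      rw [Function.onFun, Set.disjoint_left]
      rintro x ⟨hx, -⟩ ⟨hx', -⟩
      exact Set.disjoint_left.1 (hd hσ hτ hne) hx hx'
  refine ⟨∑ σ ∈ hTfin.toFinset, C σ, fun l hl => ⟨?_, ?_⟩⟩
  · rw [hsum S (fun a => 0 ≤ a) l hT1 hd1, Polynomial.eval_finsetSum]
    exact Finset.sum_congr rfl fun σ _ => (hC σ l hl).1
  · rw [hsum (fun σ => (S σ)ᶜ) (fun a => ∀ i, 0 < a i) l hT2 hd2, Polynomial.eval_finsetSum,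
      Finset.mul_sum]
    refine Finset.sum_congr rfl fun σ _ => ?_
    rw [(hC σ l hl).2, hcard]
    congr 1
    ring

end LatticeCone

/-! ### Relative interiors and exposed faces of polytopes -/

section ConvexGeometry

variable {V : Type*} [NormedAddCommGroup V] [NormedSpace ℝ V]

theorem mem_convexHull_range_iff {ι : Type*} [Fintype ι] (p : ι → V) (x : V) :
    x ∈ convexHull ℝ (Set.range p) ↔
      ∃ a : ι → ℝ, 0 ≤ a ∧ ∑ i, a i = 1 ∧ ∑ i, a i • p i = x := by
  classical
  constructor
  · intro hx
    have hsub : convexHull ℝ (Set.range p) ⊆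
        (Fintype.linearCombination ℝ p) '' stdSimplex ℝ ι := by
      refine convexHull_min ?_ ((convex_stdSimplex ℝ ι).linear_image _)
      rintro _ ⟨i, rfl⟩
      exact ⟨Pi.single i 1, single_mem_stdSimplex ℝ i, by simp⟩
    obtain ⟨a, ha, hax⟩ := hsub hx
    exact ⟨a, ha.1, ha.2, by simpa [Fintype.linearCombination_apply] using hax⟩
  · rintro ⟨a, h0, h1, rfl⟩
    exact (convex_convexHull ℝ _).sum_mem (fun i _ => h0 i) h1
      fun i _ => subset_convexHull ℝ _ ⟨i, rfl⟩

theorem mem_intrinsicInterior_iff_dist {s : Set V} {x : V} :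
    x ∈ intrinsicInterior ℝ s ↔ x ∈ affineSpan ℝ s ∧
      ∃ r > 0, ∀ y ∈ affineSpan ℝ s, dist y x < r → y ∈ s := by
  rw [mem_intrinsicInterior]
  constructor
  · rintro ⟨y, hy, rfl⟩
    rw [mem_interior_iff_mem_nhds, Metric.mem_nhds_iff] at hy
    obtain ⟨r, hr, h⟩ := hy
    exact ⟨y.2, r, hr, fun z hz hd => h (show (⟨z, hz⟩ : affineSpan ℝ s) ∈ _ from hd)⟩
  · rintro ⟨hx, r, hr, h⟩
    refine ⟨⟨x, hx⟩, ?_, rfl⟩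
    rw [mem_interior_iff_mem_nhds, Metric.mem_nhds_iff]
    exact ⟨r, hr, fun z hz => h z z.2 hz⟩

theorem exists_add_smul_sub_mem_of_mem_intrinsicInterior {s : Set V} {x c : V}
    (hx : x ∈ intrinsicInterior ℝ s) (hc : c ∈ s) : ∃ δ : ℝ, 0 < δ ∧ x + δ • (x - c) ∈ s := by
  obtain ⟨hxs, r, hr, h⟩ := mem_intrinsicInterior_iff_dist.1 hx
  have hpos : 0 < ‖x - c‖ + 1 := by positivity
  refine ⟨r / (‖x - c‖ + 1), by positivity, h _ ?_ ?_⟩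
  · rw [add_comm]
    exact AffineSubspace.smul_vsub_vadd_mem _ _ hxs (subset_affineSpan ℝ s hc) hxs
  · rw [dist_eq_norm, add_sub_cancel_left, norm_smul, Real.norm_of_nonneg (by positivity),
      div_mul_eq_mul_div, div_lt_iff₀ hpos]
    nlinarith

/-- The homothety of centre y and ratio b carries a relative ball around z to one around the new
point. -/
theorem Convex.add_smul_mem_intrinsicInterior {s : Set V} (hs : Convex ℝ s) {z y : V}
    (hz : z ∈ intrinsicInterior ℝ s) (hy : y ∈ s) {b : ℝ} (hb : 0 < b) (hb1 : b ≤ 1) :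
    b • z + (1 - b) • y ∈ intrinsicInterior ℝ s := by
  obtain ⟨hzs, r, hr, h⟩ := mem_intrinsicInterior_iff_dist.1 hz
  have hmem : b • z + (1 - b) • y ∈ s :=
    hs (intrinsicInterior_subset hz) hy hb.le (by linarith) (by ring)
  have hspan := subset_affineSpan ℝ s hmem
  refine mem_intrinsicInterior_iff_dist.2 ⟨hspan, b * r, by positivity, fun a ha hd => ?_⟩
  have hz' : b⁻¹ • (a - (b • z + (1 - b) • y)) + z ∈ s := by
    refine h _ (AffineSubspace.smul_vsub_vadd_mem _ _ ha hspan hzs) ?_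
    rw [dist_eq_norm, add_sub_cancel_right, norm_smul, norm_inv, Real.norm_of_nonneg hb.le,
      inv_mul_lt_iff₀ hb, ← dist_eq_norm]
    exact hd
  have := hs hz' hy hb.le (show 0 ≤ 1 - b by linarith) (by ring)
  convert! this using 1
  rw [smul_add, smul_smul, mul_inv_cancel₀ hb.ne', one_smul]
  abel

variable [FiniteDimensional ℝ V]

theorem mem_intrinsicInterior_convexHull_range_iff {ι : Type*} [Fintype ι] [Nonempty ι]
    (p : ι → V) (x : V) :
    x ∈ intrinsicInterior ℝ (convexHull ℝ (Set.range p)) ↔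
      ∃ a : ι → ℝ, (∀ i, 0 < a i) ∧ ∑ i, a i = 1 ∧ ∑ i, a i • p i = x := by
  have hconv := convex_convexHull ℝ (Set.range p)
  constructor
  · intro hx
    -- Prolong the segment from the barycentre through x slightly beyond x; then x is a convex
    -- combination in which the barycentre has positive weight.
    set k : ℝ := (Fintype.card ι : ℝ)⁻¹ with hk
    have hk0 : 0 < k := by
      rw [hk]
      have : 0 < Fintype.card ι := Fintype.card_pos
      positivity
    have hksum : ∑ _i : ι, k = 1 := by
      rw [Finset.sum_const, Finset.card_univ, nsmul_eq_mul, hk]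
      exact mul_inv_cancel₀ (by exact_mod_cast Fintype.card_ne_zero)
    obtain ⟨δ, hδ, hmem⟩ := exists_add_smul_sub_mem_of_mem_intrinsicInterior hx
      ((mem_convexHull_range_iff p _).2 ⟨fun _ => k, fun _ => hk0.le, hksum, rfl⟩)
    obtain ⟨b, hb, hb1, hbx⟩ := (mem_convexHull_range_iff p _).1 hmem
    have h1 : (1 + δ) ≠ 0 := by positivity
    refine ⟨fun i => (1 + δ)⁻¹ * (b i + δ * k), fun i => ?_, ?_, ?_⟩
    · have : 0 ≤ b i := hb i
      positivity
    · rw [← Finset.mul_sum, Finset.sum_add_distrib, hb1, ← Finset.mul_sum, hksum, mul_one,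
        inv_mul_cancel₀ h1]
    · simp only [mul_smul, add_smul, ← Finset.smul_sum, Finset.sum_add_distrib, hbx]
      rw [inv_smul_eq_iff₀ h1]
      module
  · rintro ⟨a, ha, ha1, rfl⟩
    have hne : (convexHull ℝ (Set.range p)).Nonempty := (Set.range_nonempty p).convexHull
    obtain ⟨z, hz⟩ := hne.intrinsicInterior hconv
    obtain ⟨c, hc, hc1, hcz⟩ := (mem_convexHull_range_iff p z).1 (intrinsicInterior_subset hz)
    obtain ⟨i₀, -, hi₀⟩ := Finset.exists_min_image Finset.univ a Finset.univ_nonempty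
    have hcle : ∀ i, c i ≤ 1 := fun i => by
      rw [← hc1]
      exact Finset.single_le_sum (fun i _ => hc i) (Finset.mem_univ i)
    have hale : a i₀ ≤ 1 := by
      rw [← ha1]
      exact Finset.single_le_sum (fun i _ => (ha i).le) (Finset.mem_univ i₀)
    -- Half the least coefficient of x: small enough that x - b • z still has non-negative
    -- coefficients, so x lies strictly between z and a point of the hull.
    set b : ℝ := a i₀ / 2 with hb
    have hb0 : 0 < b := by have := ha i₀; positivity
    have hb1 : b < 1 := by linarith
    have hb2 : (1 - b) ≠ 0 := by linarith
    have hy : (1 - b)⁻¹ • (∑ i, a i • p i - b • z) ∈ convexHull ℝ (Set.range p) := by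
      refine (mem_convexHull_range_iff p _).2 ⟨fun i => (1 - b)⁻¹ * (a i - b * c i),
        fun i => ?_, ?_, ?_⟩
      · have h1 := hi₀ i (Finset.mem_univ i)
        have h2 := hcle i
        have h3 : 0 ≤ (1 - b)⁻¹ := inv_nonneg.2 (by linarith)
        exact mul_nonneg h3 (by nlinarith)
      · rw [← Finset.mul_sum, Finset.sum_sub_distrib, ha1, ← Finset.mul_sum, hc1, mul_one,
          inv_mul_cancel₀ hb2]
      · simp only [mul_smul, sub_smul, ← Finset.smul_sum, Finset.sum_sub_distrib, hcz]
    have := hconv.add_smul_mem_intrinsicInterior hz hy hb0 hb1.le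
    rwa [smul_smul, mul_inv_cancel₀ hb2, one_smul, add_sub_cancel] at this

omit [FiniteDimensional ℝ V] in
theorem smul_convexHull_range {ι : Type*} (p : ι → V) (l : ℝ) :
    l • convexHull ℝ (Set.range p) = convexHull ℝ (Set.range fun i => l • p i) := by
  rw [← convexHull_smul]
  congr 1
  exact Set.smul_set_range _ _

omit [FiniteDimensional ℝ V] in
theorem mem_smul_convexHull_range_iff {ι : Type*} [Fintype ι] (p : ι → V) {l : ℝ} (hl : 0 < l)
    (x : V) : x ∈ l • convexHull ℝ (Set.range p) ↔
      ∃ a : ι → ℝ, 0 ≤ a ∧ ∑ i, a i = l ∧ ∑ i, a i • p i = x := by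
  rw [smul_convexHull_range, mem_convexHull_range_iff]
  constructor
  · rintro ⟨a, ha, ha1, hax⟩
    refine ⟨fun i => l * a i, fun i => mul_nonneg hl.le (ha i), ?_, ?_⟩
    · rw [← Finset.mul_sum, ha1, mul_one]
    · rw [← hax]
      exact Finset.sum_congr rfl fun i _ => by rw [smul_smul, mul_comm]
  · rintro ⟨a, ha, ha1, hax⟩
    refine ⟨fun i => l⁻¹ * a i, fun i => mul_nonneg (inv_nonneg.2 hl.le) (ha i), ?_, ?_⟩
    · rw [← Finset.mul_sum, ha1, inv_mul_cancel₀ hl.ne']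
    · rw [← hax]
      refine Finset.sum_congr rfl fun i _ => ?_
      rw [smul_smul]
      congr 1
      field_simp

theorem mem_intrinsicInterior_smul_convexHull_range_iff {ι : Type*} [Fintype ι] [Nonempty ι]
    (p : ι → V) {l : ℝ} (hl : 0 < l) (x : V) :
    x ∈ intrinsicInterior ℝ (l • convexHull ℝ (Set.range p)) ↔
      ∃ a : ι → ℝ, (∀ i, 0 < a i) ∧ ∑ i, a i = l ∧ ∑ i, a i • p i = x := by
  rw [smul_convexHull_range, mem_intrinsicInterior_convexHull_range_iff]
  constructor
  · rintro ⟨a, ha, ha1, hax⟩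
    refine ⟨fun i => l * a i, fun i => mul_pos hl (ha i), ?_, ?_⟩
    · rw [← Finset.mul_sum, ha1, mul_one]
    · rw [← hax]
      exact Finset.sum_congr rfl fun i _ => by rw [smul_smul, mul_comm]
  · rintro ⟨a, ha, ha1, hax⟩
    refine ⟨fun i => l⁻¹ * a i, fun i => mul_pos (inv_pos.2 hl) (ha i), ?_, ?_⟩
    · rw [← Finset.mul_sum, ha1, inv_mul_cancel₀ hl.ne']
    · rw [← hax]
      refine Finset.sum_congr rfl fun i _ => ?_
      rw [smul_smul]
      congr 1
      field_simp

-- An average of values of g that attains the maximum of g forces the maximum at every point of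
-- positive weight.
omit [FiniteDimensional ℝ V] in
theorem IsExposed.mem_of_sum_mem {C Q : Set V} (hQ : IsExposed ℝ C Q) {ι : Type*} [Fintype ι]
    {z : ι → V} (hz : ∀ i, z i ∈ C) {a : ι → ℝ} (ha : 0 ≤ a) (ha1 : ∑ i, a i = 1)
    (hmem : ∑ i, a i • z i ∈ Q) (i : ι) (hi : 0 < a i) : z i ∈ Q := by
  obtain ⟨g, rfl⟩ := hQ ⟨_, hmem⟩
  obtain ⟨hC, hmax⟩ := hmem
  set x := ∑ i, a i • z i with hx
  have hgx : g x = ∑ i, a i * g (z i) := by simp [hx]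
  have hge : g x ≤ g (z i) := by
    by_contra! hlt
    have : ∑ i, a i * g (z i) < ∑ i, a i * g x :=
      Finset.sum_lt_sum (fun j _ => mul_le_mul_of_nonneg_left (hmax _ (hz j)) (ha j))
        ⟨i, Finset.mem_univ i, mul_lt_mul_of_pos_left hlt hi⟩
    rw [← Finset.sum_mul, ha1, one_mul] at this
    linarith
  exact ⟨hz i, fun y hy => (hmax y hy).trans hge⟩

omit [FiniteDimensional ℝ V] in
theorem IsExposed.eq_convexHull_range {ι : Type*} [Fintype ι] {p : ι → V} {Q : Set V}
    (hQ : IsExposed ℝ (convexHull ℝ (Set.range p)) Q) :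
    Q = convexHull ℝ (Set.range fun i : {i // p i ∈ Q} => p i) := by
  classical
  apply Set.Subset.antisymm
  · intro x hx
    obtain ⟨a, ha, ha1, hax⟩ := (mem_convexHull_range_iff p x).1 (hQ.subset hx)
    have hz : ∀ i, p i ∉ Q → a i = 0 := by
      intro i hi
      by_contra h
      exact hi (hQ.mem_of_sum_mem (fun i => subset_convexHull ℝ _ ⟨i, rfl⟩) ha ha1
        (hax.symm ▸ hx) i (lt_of_le_of_ne (ha i) (Ne.symm h)))
    refine (mem_convexHull_range_iff _ x).2 ⟨fun i => a i, fun i => ha i, ?_, ?_⟩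
    · rw [← ha1, sum_eq_sum_subtype hz]
    · rw [← hax, sum_eq_sum_subtype (f := fun i => a i • p i) fun i hi => by
        rw [hz i hi, zero_smul]]
  · refine convexHull_min ?_ (hQ.convex (convex_convexHull ℝ _))
    rintro _ ⟨i, rfl⟩
    exact i.2

theorem IsExposed.subset_of_mem_intrinsicInterior {ι : Type*} [Fintype ι] {p : ι → V}
    {Q G : Set V} (hQ : IsExposed ℝ (convexHull ℝ (Set.range p)) Q)
    (hG : IsExposed ℝ (convexHull ℝ (Set.range p)) G) {x : V}
    (hxQ : x ∈ intrinsicInterior ℝ Q) (hxG : x ∈ G) : Q ⊆ G := by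
  classical
  have hrange := hQ.eq_convexHull_range
  have hne : Nonempty {i // p i ∈ Q} := by
    have h := intrinsicInterior_subset hxQ
    rw [hrange] at h
    exact Set.range_nonempty_iff_nonempty.1 (convexHull_nonempty_iff.1 ⟨x, h⟩)
  have hxQ' := hxQ
  rw [hrange, mem_intrinsicInterior_convexHull_range_iff] at hxQ'
  obtain ⟨a, ha, ha1, rfl⟩ := hxQ'
  rw [hrange]
  refine convexHull_min ?_ (hG.convex (convex_convexHull ℝ _))
  rintro _ ⟨i, rfl⟩
  exact hG.mem_of_sum_mem (z := fun i : {i // p i ∈ Q} => p i)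
    (fun i => subset_convexHull ℝ _ ⟨i.1, rfl⟩) (fun i => (ha i).le) ha1 hxG i (ha i)

/-- A point outside the relative interior of a polytope has a supporting functional that is not
constant on the polytope. -/
theorem exists_le_of_notMem_intrinsicInterior {κ : Type*} [Fintype κ] [Nonempty κ] {p : κ → V}
    {x : V} (hx : x ∉ intrinsicInterior ℝ (convexHull ℝ (Set.range p))) :
    ∃ f : V →L[ℝ] ℝ, (∀ i, f (p i) ≤ f x) ∧ ∃ i, f (p i) < f x := by
  classical
  -- The positive combinations of the p i - x form an open convex subset of D, and 0 would lie in it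
  -- only if x were in the relative interior. Separate 0 from it inside D, then extend the
  -- functional to V.
  set D := Submodule.span ℝ (Set.range fun i => p i - x) with hD
  let e : κ → D := fun i => ⟨p i - x, Submodule.subset_span ⟨i, rfl⟩⟩
  let L : (κ → ℝ) →ₗ[ℝ] D := Fintype.linearCombination ℝ e
  have hL : ∀ a, L a = ∑ i, a i • e i := fun a => Fintype.linearCombination_apply ..
  have hLsurj : Function.Surjective L := by
    rw [← LinearMap.range_eq_top, Fintype.range_linearCombination]
    apply Submodule.map_injective_of_injective D.injective_subtype
    rw [Submodule.map_span, Submodule.map_top, Submodule.range_subtype, ← Set.range_comp]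
    rfl
  have hopen : IsOpen (L '' {a | ∀ i, 0 < a i}) := by
    apply L.isOpenMap_of_finiteDimensional hLsurj
    have : {a : κ → ℝ | ∀ i, 0 < a i} = Set.univ.pi fun _ => Set.Ioi 0 := by
      ext a
      simp
    rw [this]
    exact isOpen_set_pi Set.finite_univ fun _ _ => isOpen_Ioi
  have hconv : Convex ℝ (L '' {a | ∀ i, 0 < a i}) := by
    refine Convex.linear_image ?_ L
    have : {a : κ → ℝ | ∀ i, 0 < a i} = Set.univ.pi fun _ => Set.Ioi 0 := by
      ext a
      simp
    rw [this]
    exact convex_pi fun _ _ => convex_Ioi 0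
  have h0 : (0 : D) ∉ L '' {a | ∀ i, 0 < a i} := by
    rintro ⟨a, ha, ha0⟩
    apply hx
    rw [mem_intrinsicInterior_convexHull_range_iff]
    have hA : 0 < ∑ i, a i := Finset.sum_pos (fun i _ => ha i) Finset.univ_nonempty
    refine ⟨fun i => (∑ j, a j)⁻¹ * a i, fun i => mul_pos (inv_pos.2 hA) (ha i), ?_, ?_⟩
    · rw [← Finset.mul_sum, inv_mul_cancel₀ hA.ne']
    · have h1 := congrArg Subtype.val ha0
      rw [hL, Submodule.coe_sum] at h1
      simp only [e, Submodule.coe_smul, smul_sub, Finset.sum_sub_distrib, ← Finset.sum_smul,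
        Submodule.coe_zero, sub_eq_zero] at h1
      simp only [mul_smul, ← Finset.smul_sum, h1]
      rw [smul_smul, inv_mul_cancel₀ hA.ne', one_smul]
  obtain ⟨f, hf⟩ := geometric_hahn_banach_open_point hconv hopen h0
  obtain ⟨F, hF⟩ := LinearMap.exists_extend f.toLinearMap
  have hFe : ∀ i, F (p i) - F x = f (e i) := by
    intro i
    rw [← map_sub]
    exact LinearMap.congr_fun hF (e i)
  have hneg : ∀ a : κ → ℝ, (∀ i, 0 < a i) → ∑ i, a i * f (e i) < 0 := by
    intro a ha
    have := hf _ ⟨a, ha, rfl⟩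
    rw [hL, map_sum, map_zero] at this
    simpa using this
  refine ⟨LinearMap.toContinuousLinearMap F, fun i => ?_, ?_⟩
  · rw [LinearMap.coe_toContinuousLinearMap', ← sub_nonpos, hFe]
    by_contra! hpos
    set s := ∑ j, f (e j) with hs
    -- These weights make the combination s + |s|, which is not negative.
    have := hneg (fun j => 1 + if j = i then |s| / f (e i) else 0) fun j => by
      split_ifs <;> positivity
    simp only [add_mul, one_mul, Finset.sum_add_distrib, ite_mul, zero_mul, Finset.sum_ite_eq',
      Finset.mem_univ, if_true, div_mul_cancel₀ _ hpos.ne'] at this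
    linarith [neg_abs_le s]
  · by_contra! hge
    have := hneg (fun _ => 1) fun _ => one_pos
    have h2 : 0 ≤ ∑ i, 1 * f (e i) := Finset.sum_nonneg fun i _ => by
      rw [one_mul, ← hFe]
      exact sub_nonneg.2 (hge i)
    linarith

/-- Every point of a polytope lies in the relative interior of an exposed face. -/
theorem exists_isExposed_mem_intrinsicInterior {ι : Type*} [Fintype ι] {p : ι → V} {x : V}
    (hx : x ∈ convexHull ℝ (Set.range p)) :
    ∃ Q, IsExposed ℝ (convexHull ℝ (Set.range p)) Q ∧ x ∈ intrinsicInterior ℝ Q := by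
  classical
  set C := convexHull ℝ (Set.range p) with hC
  set A : Set (Set V) := {Q | IsExposed ℝ C Q ∧ x ∈ Q} with hA
  have hne : A.Nonempty := ⟨C, IsExposed.refl C, hx⟩
  -- Among the exposed faces through x take one with the fewest generators. Were x outside its
  -- relative interior, a supporting functional would cut out a smaller one.
  obtain ⟨Q, ⟨hQ, hxQ⟩, hmin⟩ : ∃ Q ∈ A, ∀ H ∈ A, (Finset.univ.filter fun i => p i ∈ Q).card ≤
      (Finset.univ.filter fun i => p i ∈ H).card :=
    ⟨Function.argminOn (fun Q : Set V => (Finset.univ.filter fun i => p i ∈ Q).card) A hne,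
      Function.argminOn_mem _ _ _, fun b hb => Function.argminOn_le
        (fun Q : Set V => (Finset.univ.filter fun i => p i ∈ Q).card) A hb⟩
  refine ⟨Q, hQ, ?_⟩
  by_contra hrel
  have hrange := hQ.eq_convexHull_range
  have hne' : Nonempty {i // p i ∈ Q} := by
    rw [hrange] at hxQ
    exact Set.range_nonempty_iff_nonempty.1 (convexHull_nonempty_iff.1 ⟨x, hxQ⟩)
  rw [hrange] at hrel
  obtain ⟨f, hf, j, hj⟩ := exists_le_of_notMem_intrinsicInterior hrel
  obtain ⟨g, hg⟩ := hQ ⟨x, hxQ⟩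
  have hpC : ∀ i, p i ∈ C := fun i => subset_convexHull ℝ _ ⟨i, rfl⟩
  have hgmax : ∀ y ∈ C, g y ≤ g x := by
    rw [hg] at hxQ
    exact hxQ.2
  have hgQ : ∀ i, p i ∈ Q → g (p i) = g x := by
    intro i hi
    rw [hg] at hi
    exact le_antisymm (hgmax _ hi.1) (hi.2 x hx)
  have hgnot : ∀ i, p i ∉ Q → g (p i) < g x := by
    intro i hi
    by_contra! hge
    apply hi
    rw [hg]
    exact ⟨hpC i, fun y hy => (hgmax y hy).trans hge⟩
  -- The functional f supports only Q. Adding a large multiple of g, which exposes Q in C, yields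
  -- one that supports all of C, so the smaller face is exposed in C as well.
  obtain ⟨N, hN⟩ : ∃ N : ℝ, ∀ i : {i // p i ∉ Q}, f (p i) - f x < N * (g x - g (p i)) := by
    have : ∀ᶠ N : ℝ in Filter.atTop, ∀ i : {i // p i ∉ Q},
        f (p i) - f x < N * (g x - g (p i)) := by
      rw [Filter.eventually_all]
      intro i
      exact (Filter.tendsto_id.atTop_mul_const (sub_pos.2 (hgnot i i.2))).eventually_gt_atTop _
    exact this.exists
  set h : V →L[ℝ] ℝ := N • g + f with hh
  have hval : ∀ y, h y = N * g y + f y := fun y => by simp [hh]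
  have hnot : ∀ i, p i ∉ Q → h (p i) < h x := by
    intro i hi
    have := hN ⟨i, hi⟩
    rw [hval, hval]
    simp only at this
    linarith
  have hle : ∀ i, h (p i) ≤ h x := by
    intro i
    by_cases hi : p i ∈ Q
    · rw [hval, hval, hgQ i hi]
      linarith [hf ⟨i, hi⟩]
    · exact (hnot i hi).le
  set H : Set V := {y ∈ C | ∀ z ∈ C, h z ≤ h y} with hH
  have hHA : H ∈ A := by
    refine ⟨fun _ => ⟨h, rfl⟩, hx, fun z hz => ?_⟩
    have : C ⊆ {z | h z ≤ h x} := by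
      refine convexHull_min ?_ (convex_halfSpace_le h.isLinear _)
      rintro _ ⟨i, rfl⟩
      exact hle i
    exact this hz
  refine absurd (hmin H hHA) (not_le.2 (Finset.card_lt_card ?_))
  rw [Finset.ssubset_iff_of_subset]
  · refine ⟨j, by simpa using j.2, ?_⟩
    simp only [Finset.mem_filter, Finset.mem_univ, true_and]
    intro hjH
    have h1 := hjH.2 x hx
    rw [hval, hval, hgQ j j.2] at h1
    linarith
  · intro i
    simp only [Finset.mem_filter, Finset.mem_univ, true_and]
    intro hi
    by_contra hiQ
    exact absurd (hi.2 x hx) (not_le.2 (hnot i hiQ))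

end ConvexGeometry

/-! ### Reciprocity for the faces of a lattice polytope -/

theorem intrinsicInterior_smul {V : Type*} [NormedAddCommGroup V] [NormedSpace ℝ V]
    [FiniteDimensional ℝ V] {l : ℝ} (hl : l ≠ 0) (s : Set V) :
    intrinsicInterior ℝ (l • s) = l • intrinsicInterior ℝ s :=
  AffineEquiv.intrinsicInterior_image (LinearEquiv.smulOfNeZero ℝ V l hl).toAffineEquiv s

namespace LatticePolytope

variable {n : ℕ} {P : LatticePolytope n}

theorem exists_carrier_eq_convexHull_range (P : LatticePolytope n) : ∃ s : Finset (Fin n → ℤ),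
    P.carrier = convexHull ℝ (Set.range fun i : s => latticeVec i.1) := by
  obtain ⟨s, hs⟩ := P.isLattice
  refine ⟨s, ?_⟩
  rw [hs]
  congr 1
  ext x
  simp

theorem Face.exists_convexHull_range (Q : P.Face) :
    ∃ (ι : Type) (_ : Fintype ι) (_ : Nonempty ι) (p : ι → Fin n → ℤ),
      Q.pts = convexHull ℝ (Set.range fun i => latticeVec (p i)) := by
  classical
  obtain ⟨s, hs⟩ := P.exists_carrier_eq_convexHull_range
  have hQ : IsExposed ℝ P.carrier Q.pts := Q.2.2
  rw [hs] at hQ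
  have hrange := hQ.eq_convexHull_range
  refine ⟨{i : s // latticeVec i.1 ∈ Q.pts}, inferInstance, ?_, fun i => i.1.1, hrange⟩
  have hne : Q.pts.Nonempty := Q.2.1
  rw [hrange] at hne
  exact Set.range_nonempty_iff_nonempty.1 (convexHull_nonempty_iff.1 hne)

theorem Face.subset_of_mem_intrinsicInterior {Q G : P.Face} {x : Fin n → ℝ}
    (hxQ : x ∈ intrinsicInterior ℝ Q.pts) (hxG : x ∈ G.pts) : Q.pts ⊆ G.pts := by
  obtain ⟨s, hs⟩ := P.exists_carrier_eq_convexHull_range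
  have hQ : IsExposed ℝ P.carrier Q.pts := Q.2.2
  have hG : IsExposed ℝ P.carrier G.pts := G.2.2
  rw [hs] at hQ hG
  exact hQ.subset_of_mem_intrinsicInterior hG hxQ hxG

theorem exists_face_mem_intrinsicInterior {x : Fin n → ℝ} (hx : x ∈ P.carrier) :
    ∃ Q : P.Face, x ∈ intrinsicInterior ℝ Q.pts := by
  obtain ⟨s, hs⟩ := P.exists_carrier_eq_convexHull_range
  rw [hs] at hx
  obtain ⟨Q, hQ, hxQ⟩ := exists_isExposed_mem_intrinsicInterior hx
  exact ⟨⟨Q, ⟨x, intrinsicInterior_subset hxQ⟩, by rwa [hs]⟩, hxQ⟩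

theorem relintSum_eq_finsum (φ : MvPolynomial (Fin n) ℂ) (Q : P.Face) (l : ℕ) :
    relintSum φ Q l = ∑ᶠ m ∈ relintPoints Q l, evalLattice φ m :=
  (finsum_mem_eq_finite_toFinset_sum _ _).symm

-- Each point of Q lies in the relative interior of exactly one face F of P, and F ⊆ Q because Q is
-- a face containing a relative interior point of F.
open Classical in
theorem finsum_dilate_eq_sum_relintSum (φ : MvPolynomial (Fin n) ℂ) (Q : P.Face) {l : ℕ}
    (hl : 0 < l) : ∑ᶠ m ∈ {m : Fin n → ℤ | latticeVec m ∈ (l : ℝ) • Q.pts}, evalLattice φ m =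
      ∑ F : P.Face with F.pts ⊆ Q.pts, relintSum φ F l := by
  have hl0 : (l : ℝ) ≠ 0 := by exact_mod_cast hl.ne'
  have hset : {m : Fin n → ℤ | latticeVec m ∈ (l : ℝ) • Q.pts} =
      ⋃ F ∈ {F : P.Face | F.pts ⊆ Q.pts}, relintPoints F l := by
    ext m
    simp only [relintPoints, Set.mem_ofPred_eq, Set.mem_iUnion, exists_prop,
      intrinsicInterior_smul hl0, Set.mem_smul_set_iff_inv_smul_mem₀ hl0]
    constructor
    · intro hm
      obtain ⟨F, hF⟩ := exists_face_mem_intrinsicInterior (Q.2.2.subset hm)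
      exact ⟨F, Face.subset_of_mem_intrinsicInterior hF hm, hF⟩
    · rintro ⟨F, hFQ, hF⟩
      exact hFQ (intrinsicInterior_subset hF)
  rw [hset, finsum_mem_biUnion ?_ (Set.toFinite _) fun F _ => finite_relintPoints F l]
  · rw [← finsum_mem_coe_finset]
    exact finsum_mem_congr (by simp) fun F _ => (relintSum_eq_finsum φ F l).symm
  · intro F _ G _ hne
    rw [Function.onFun, Set.disjoint_left]
    intro m hF hG
    simp only [relintPoints, Set.mem_ofPred_eq, intrinsicInterior_smul hl0,
      Set.mem_smul_set_iff_inv_smul_mem₀ hl0] at hF hG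
    exact hne (Subtype.ext (Set.Subset.antisymm
      (Face.subset_of_mem_intrinsicInterior hF (intrinsicInterior_subset hG))
      (Face.subset_of_mem_intrinsicInterior hG (intrinsicInterior_subset hF))))

open Classical in
/-- Ehrhart–Macdonald reciprocity with polynomial weights, for the faces of a lattice polytope. -/
theorem Face.exists_polynomial_relintSum (Q : P.Face) {φ : MvPolynomial (Fin n) ℂ} {d : ℕ}
    (hφ : φ.IsHomogeneous d) : ∃ R : Polynomial ℂ, ∀ l : ℕ, 0 < l →
      R.eval (l : ℂ) = relintSum φ Q l ∧
      R.eval (-(l : ℂ)) = (-1) ^ (Q.dim + d) * ∑ F : P.Face with F.pts ⊆ Q.pts, relintSum φ F l := by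
  obtain ⟨ι, _, _, p, hp⟩ := Q.exists_convexHull_range
  obtain ⟨C, hC⟩ := exists_polynomial_cone p hφ
  have hdim : Q.dim = Module.finrank ℝ (vectorSpan ℝ (Set.range fun i => latticeVec (p i))) := by
    rw [Face.dim, hp, ← direction_affineSpan, affineSpan_convexHull, direction_affineSpan]
  rw [← hdim] at hC
  -- The polynomial C sums over ℓQ at ℓ and, up to sign, over its relative interior at -ℓ; reversing
  -- argument and sign interchanges the two.
  refine ⟨Polynomial.C ((-1) ^ (Q.dim + d)) * C.comp (-Polynomial.X), fun l hl => ?_⟩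
  have hl' : (0 : ℝ) < l := by exact_mod_cast hl
  obtain ⟨h1, h2⟩ := hC l (by exact_mod_cast hl)
  have e1 : {m | ∃ a : ι → ℝ, 0 ≤ a ∧ ∑ i, a i = ((l : ℤ) : ℝ) ∧
      ∑ i, a i • latticeVec (p i) = latticeVec m} =
      {m : Fin n → ℤ | latticeVec m ∈ (l : ℝ) • Q.pts} := by
    ext m
    rw [Set.mem_ofPred_eq, Set.mem_ofPred_eq, hp, mem_smul_convexHull_range_iff _ hl',
      Int.cast_natCast]
  have e2 : {m | ∃ a : ι → ℝ, (∀ i, 0 < a i) ∧ ∑ i, a i = ((l : ℤ) : ℝ) ∧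
      ∑ i, a i • latticeVec (p i) = latticeVec m} = relintPoints Q l := by
    ext m
    rw [relintPoints, Set.mem_ofPred_eq, Set.mem_ofPred_eq, hp,
      mem_intrinsicInterior_smul_convexHull_range_iff _ hl', Int.cast_natCast]
  rw [e1, finsum_dilate_eq_sum_relintSum φ Q hl] at h1
  rw [e2, ← relintSum_eq_finsum] at h2
  rw [Int.cast_natCast] at h1 h2
  constructor
  · rw [Polynomial.eval_mul, Polynomial.eval_C, Polynomial.eval_comp, Polynomial.eval_neg,
      Polynomial.eval_X, h2, ← mul_assoc, ← mul_pow]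
    simp
  · rw [Polynomial.eval_mul, Polynomial.eval_C, Polynomial.eval_comp, Polynomial.eval_neg,
      Polynomial.eval_X, neg_neg, h1]

/-! ### Weighted Ehrhart polynomials over the Laurent polynomials -/

/-- A polynomial over an integral domain of characteristic zero is determined by its values at the
positive integers. -/
theorem polynomial_eq_of_eval_nat_eq {R : Type*} [CommRing R] [IsDomain R] [CharZero R]
    {p q : Polynomial R} (h : ∀ l : ℕ, 0 < l → p.eval (l : R) = q.eval (l : R)) : p = q := by
  refine Polynomial.eq_of_infinite_eval_eq p q
    (((Set.Ioi_infinite (0 : ℕ)).image (f := fun l : ℕ => (l : R))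
      Nat.cast_injective.injOn).mono ?_)
  rintro _ ⟨l, hl, rfl⟩
  exact h l hl

instance : CharZero ℂ[T;T⁻¹] :=
  charZero_of_injective_ringHom (f := (LaurentPolynomial.C : ℂ →+* ℂ[T;T⁻¹]))
    (RingHom.injective _)

theorem toComplex_C_mul_T (a : ℤ) (k : ℤ) :
    toComplex (LaurentPolynomial.C a * LaurentPolynomial.T k) =
      LaurentPolynomial.C (a : ℂ) * LaurentPolynomial.T k := by
  rw [← LaurentPolynomial.single_eq_C_mul_T, ← LaurentPolynomial.single_eq_C_mul_T]
  exact AddMonoidAlgebra.mapRingHom_single ..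

theorem toComplex_T (k : ℤ) : toComplex (LaurentPolynomial.T k) = LaurentPolynomial.T k := by
  simpa using toComplex_C_mul_T 1 k

theorem invert_toComplex (x : ℤ[T;T⁻¹]) :
    LaurentPolynomial.invert (toComplex x) = toComplex (LaurentPolynomial.invert x) := by
  induction x using LaurentPolynomial.induction_on' with
  | add p q hp hq => simp only [map_add, hp, hq]
  | C_mul_T k a =>
    rw [toComplex_C_mul_T, map_mul, map_mul, LaurentPolynomial.invert_C, LaurentPolynomial.invert_C,
      LaurentPolynomial.invert_T, LaurentPolynomial.invert_T, toComplex_C_mul_T]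

/-- The weighted Ehrhart polynomial with coefficients `c Q` of the face polynomials `R Q`. -/
noncomputable def facePolynomial (c : P.Face → ℂ[T;T⁻¹]) (R : P.Face → Polynomial ℂ) :
    Polynomial ℂ[T;T⁻¹] :=
  ∑ Q : P.Face, Polynomial.C (c Q) * (R Q).map LaurentPolynomial.C

theorem facePolynomial_eval_intCast (c : P.Face → ℂ[T;T⁻¹]) (R : P.Face → Polynomial ℂ) (z : ℤ) :
    (facePolynomial c R).eval (z : ℂ[T;T⁻¹]) =
      ∑ Q : P.Face, c Q * LaurentPolynomial.C ((R Q).eval (z : ℂ)) := by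
  rw [facePolynomial, Polynomial.eval_finsetSum]
  refine Finset.sum_congr rfl fun Q _ => ?_
  rw [Polynomial.eval_mul, Polynomial.eval_C, ← map_intCast (LaurentPolynomial.C : ℂ →+* ℂ[T;T⁻¹]),
    Polynomial.eval_map_apply]

theorem isEhrhart_facePolynomial {φ : MvPolynomial (Fin n) ℂ} {R : P.Face → Polynomial ℂ}
    (hR : ∀ Q, ∀ l : ℕ, 0 < l → (R Q).eval (l : ℂ) = relintSum φ Q l) (e : ℕ) (f : P.Weight) :
    P.IsEhrhart φ e f (facePolynomial
      (fun Q => toComplex (f Q) * (1 + LaurentPolynomial.T 1) ^ (Q.dim + e)) R) := by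
  intro l hl
  have := facePolynomial_eval_intCast
    (fun Q => toComplex (f Q) * (1 + LaurentPolynomial.T 1) ^ (Q.dim + e)) R l
  rw [Int.cast_natCast, Int.cast_natCast] at this
  rw [this]
  exact Finset.sum_congr rfl fun Q _ => by rw [hR Q l hl]

theorem IsEhrhart.unique {φ : MvPolynomial (Fin n) ℂ} {e : ℕ} {f : P.Weight}
    {E E' : Polynomial ℂ[T;T⁻¹]} (h : P.IsEhrhart φ e f E) (h' : P.IsEhrhart φ e f E') : E = E' :=
  polynomial_eq_of_eval_nat_eq fun l hl => (h l hl).trans (h' l hl).symm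

theorem existsUnique_isEhrhart {φ : MvPolynomial (Fin n) ℂ} {d : ℕ} (hφ : φ.IsHomogeneous d)
    (e : ℕ) (f : P.Weight) : ∃! E : Polynomial ℂ[T;T⁻¹], P.IsEhrhart φ e f E := by
  choose R hR using fun Q : P.Face => Q.exists_polynomial_relintSum hφ
  exact ⟨_, isEhrhart_facePolynomial (fun Q l hl => (hR Q l hl).1) e f, fun E hE =>
    hE.unique (isEhrhart_facePolynomial (fun Q l hl => (hR Q l hl).1) e f)⟩

-- After y ↦ 1/y the powers of 1 + 1/y combine to (1 + 1/y)^(dim E + e), and the factor y^(dim E +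
-- e), from (-y)^(dim E) and y^e, turns this into (1 + y)^(dim E + e).
open Classical in
theorem invert_toComplex_dualWeight_mul (f : P.Weight) (F : P.Face) (e : ℕ) :
    LaurentPolynomial.T 1 ^ e * LaurentPolynomial.invert (toComplex (P.dualWeight f F) *
      (1 + LaurentPolynomial.T 1) ^ (F.dim + e)) =
    ∑ E : P.Face with F.pts ⊆ E.pts,
      (-1) ^ E.dim * (toComplex (f E) * (1 + LaurentPolynomial.T 1) ^ (E.dim + e)) := by
  have hT : (LaurentPolynomial.T 1 : ℂ[T;T⁻¹]) * (1 + LaurentPolynomial.T (-1)) =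
      1 + LaurentPolynomial.T 1 := by
    rw [mul_add, ← LaurentPolynomial.T_add]
    simp [add_comm]
  rw [map_mul, invert_toComplex, dualWeight, map_sum, map_sum, Finset.sum_mul, Finset.mul_sum]
  refine Finset.sum_congr rfl fun E hE => ?_
  have hFE : F.dim ≤ E.dim := Face.dim_mono (by simpa using hE)
  have hinv : LaurentPolynomial.invert (LaurentPolynomial.invert (f E)) = f E :=
    LaurentPolynomial.involutive_invert (f E)
  simp only [map_mul, map_pow, map_add, map_one, map_neg, LaurentPolynomial.invert_T, toComplex_T,
    hinv, neg_neg]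
  obtain ⟨k, hk⟩ := Nat.exists_eq_add_of_le hFE
  rw [← hT, hk, Nat.add_sub_cancel_left, mul_pow, neg_pow]
  ring

open Classical in
theorem IsEhrhart.reciprocity {φ : MvPolynomial (Fin n) ℂ} {d : ℕ} (hφ : φ.IsHomogeneous d)
    {e : ℕ} {f : P.Weight} {E E' : Polynomial ℂ[T;T⁻¹]} (hE : P.IsEhrhart φ e f E)
    (hE' : P.IsEhrhart φ e (P.dualWeight f) E') (l : ℤ) :
    E.eval ((-l : ℤ) : ℂ[T;T⁻¹]) = (-1) ^ d * (LaurentPolynomial.T 1 ^ e *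
      LaurentPolynomial.invert (E'.eval (l : ℂ[T;T⁻¹]))) := by
  choose R hR using fun Q : P.Face => Q.exists_polynomial_relintSum hφ
  have hR1 : ∀ Q, ∀ l : ℕ, 0 < l → (R Q).eval (l : ℂ) = relintSum φ Q l := fun Q l hl =>
    (hR Q l hl).1
  have hR2 : ∀ Q : P.Face, (R Q).eval ((-l : ℤ) : ℂ) =
      (-1) ^ (Q.dim + d) * ∑ F : P.Face with F.pts ⊆ Q.pts, (R F).eval (l : ℂ) := by
    intro Q
    -- Face reciprocity is known at positive integers only; as an identity of polynomials it holds
    -- at every integer l.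
    have : (R Q).comp (-Polynomial.X) =
        Polynomial.C ((-1) ^ (Q.dim + d)) * ∑ F : P.Face with F.pts ⊆ Q.pts, R F := by
      refine polynomial_eq_of_eval_nat_eq fun k hk => ?_
      rw [Polynomial.eval_comp, Polynomial.eval_neg, Polynomial.eval_X, (hR Q k hk).2,
        Polynomial.eval_mul, Polynomial.eval_C, Polynomial.eval_finsetSum]
      simp only [hR1 _ k hk]
    have h := congrArg (Polynomial.eval (l : ℂ)) this
    rw [Polynomial.eval_comp, Polynomial.eval_neg, Polynomial.eval_X, Polynomial.eval_mul,
      Polynomial.eval_C, Polynomial.eval_finsetSum] at h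
    rw [Int.cast_neg, h]
  rw [hE.unique (isEhrhart_facePolynomial hR1 e f),
    hE'.unique (isEhrhart_facePolynomial hR1 e (P.dualWeight f)),
    facePolynomial_eval_intCast, facePolynomial_eval_intCast, map_sum, Finset.mul_sum,
    Finset.mul_sum]
  have hF : ∀ F : P.Face, LaurentPolynomial.T 1 ^ e * LaurentPolynomial.invert
      (toComplex (P.dualWeight f F) * (1 + LaurentPolynomial.T 1) ^ (F.dim + e) *
        LaurentPolynomial.C ((R F).eval (l : ℂ))) =
      ∑ Q : P.Face, if F.pts ⊆ Q.pts then (-1) ^ Q.dim * (toComplex (f Q) *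
        (1 + LaurentPolynomial.T 1) ^ (Q.dim + e)) * LaurentPolynomial.C ((R F).eval (l : ℂ))
          else 0 := by
    intro F
    rw [map_mul, LaurentPolynomial.invert_C, ← mul_assoc, invert_toComplex_dualWeight_mul,
      Finset.sum_mul, Finset.sum_filter]
  simp only [hF, Finset.mul_sum]
  -- Exchange the sums over the pairs F ⊆ Q.
  rw [Finset.sum_comm]
  refine Finset.sum_congr rfl fun Q _ => ?_
  rw [hR2, map_mul, map_sum, Finset.sum_filter, Finset.mul_sum, Finset.mul_sum]
  refine Finset.sum_congr rfl fun F _ => ?_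
  split_ifs
  · rw [map_pow, map_neg, map_one]
    ring
  · simp

end LatticePolytope

theorem theorem1p3 {n : ℕ} (P : LatticePolytope n) (φ : MvPolynomial (Fin n) ℂ) (d : ℕ)
    (hφ : φ.IsHomogeneous d) :
    -- the polynomials `E(z, y)` and `Ẽ(z, y)` exist and are unique, for every weight vector
    (∀ f : P.Weight, ∃! E : Polynomial ℂ[T;T⁻¹], P.IsEhrhart φ d f E) ∧
    (∀ f : P.Weight, ∃! E : Polynomial ℂ[T;T⁻¹], P.IsRenormalizedEhrhart φ f E) ∧
    -- reciprocity for `E`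
    (∀ (f : P.Weight) (E E' : Polynomial ℂ[T;T⁻¹]),
      P.IsEhrhart φ d f E → P.IsEhrhart φ d (P.dualWeight f) E' →
      ∀ l : ℤ, E.eval ((-l : ℤ) : ℂ[T;T⁻¹]) =
        (-LaurentPolynomial.T 1) ^ d * LaurentPolynomial.invert (E'.eval (l : ℂ[T;T⁻¹]))) ∧
    -- reciprocity for `Ẽ`
    (∀ (f : P.Weight) (E E' : Polynomial ℂ[T;T⁻¹]),
      P.IsRenormalizedEhrhart φ f E → P.IsRenormalizedEhrhart φ (P.dualWeight f) E' →
      ∀ l : ℤ, E.eval ((-l : ℤ) : ℂ[T;T⁻¹]) =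
        (-1) ^ d * LaurentPolynomial.invert (E'.eval (l : ℂ[T;T⁻¹]))) := by
  -- The exponent e is independent of the degree d; for e = 0 the weighted sum is by definition the
  -- renormalized one.
  refine ⟨fun f => LatticePolytope.existsUnique_isEhrhart hφ d f,
    fun f => LatticePolytope.existsUnique_isEhrhart hφ 0 f, fun f E E' hE hE' l => ?_,
    fun f E E' hE hE' l => ?_⟩
  · rw [LatticePolytope.IsEhrhart.reciprocity hφ hE hE' l, neg_pow (LaurentPolynomial.T 1 : ℂ[T;T⁻¹]), mul_assoc]
  · have := LatticePolytope.IsEhrhart.reciprocity (e := 0) hφ hE hE' l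
    rwa [pow_zero, one_mul] at this
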